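/- Fix $\gamma\in\mathbb R$ and let $$F=L^\infty(\mathbb R)\times\bigl(L^\infty(\mathbb R)\cap L^2(\mathbb R)\bigr)\times L^\infty(\mathbb R)\times L^2(\mathbb R)\times L^2(\mathbb R)\times L^2(\mathbb R),$$ with elements $Y=(\zeta,U,H,v,w,h)$ and norm $$\|Y\|_F=\|\zeta\|_{L^\infty}+\|U\|_{L^2}+\|U\|_{L^\infty}+\|H\|_{L^\infty}+\|v\|_{L^2}+\|w\|_{L^2}+\|h\|_{L^2}.$$ Put $y(\xi)=\zeta(\xi)+\xi$, $q=v+1$, $$P(\xi)=\tfrac12\int_{\mathbb R}e^{-\operatorname{sgn}(\xi-\eta)(y(\xi)-y(\eta))}\Bigl(\tfrac{3-2\gamma}{2}U^2q+\tfrac{\gamma}{2}h\Bigr)(\eta)\,d\eta,$$ $$Q(\xi)=-\tfrac12\int_{\mathbb R}\operatorname{sgn}(\xi-\eta)\,e^{-\operatorname{sgn}(\xi-\eta)(y(\xi)-y(\eta))}\Bigl(\tfrac{3-2\gamma}{2}U^2q+\tfrac{\gamma}{2}h\Bigr)(\eta)\,d\eta .$$ A solution on $[0,T]$, $T>0$,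 is a curve $Y\in C^1([0,T],F)$ satisfying the Lagrangian system $$\zeta_t=\gamma U,\quad U_t=-Q,\quad H_t=U^3-2PU,\quad v_t=\gamma w,$$ $$w_t=\tfrac{\gamma}{2}h+\bigl(\tfrac{3-2\gamma}{2}U^2-P\bigr)q,\qquad h_t=-2QUq+(3U^2-2P)w .$$ Let $F^e$ be the set of $Y\in F$ with $q,w,h\in L^\infty$, $e^{|\xi|/2}U,\ e^{|\xi|/2}w\in L^2$ and $e^{|\xi|}h\in L^1$, with $$\|Y\|_{F^e}=\|Y\|_F+\|q\|_{L^\infty}+\|w\|_{L^\infty}+\|h\|_{L^\infty}+\|e^{|\xi|/2}U\|_{L^2}+\|e^{|\xi|/2}w\|_{L^2}+\|e^{|\xi|}h\|_{L^1}.$$ For $\alpha>1$ let $F^\alpha$ be the set of $Y\in F$ with $q,w,h\in L^\infty$, $(1+|\xi|)^{\alpha/2}U,\ (1+|\xi|)^{\alpha/2}w\in L^2$ and $(1+|\xi|)^\alpha h\in L^1$, with $$\|Y\|_{F^\alpha}=\|Y\|_F+\|q\|_{L^\infty}+\|w\|_{L^\infty}+\|h\|_{L^\infty}+\|(1+|\xi|)^{\alpha/2}U\|_{L^2}+\|(1+|\xi|)^{\alpha/2}w\|_{L^2}+\|(1+|\xi|)^{\alpha}h\|_{L^1}.$$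 **Theorem.** Solutions are uniquely determined on $[0,T]$ by $Y(0)$. There is a function $\tau:\mathbb R\to(0,\infty)$ such that for every $Y_0\in F$ there is a solution on $[0,\tau(\|Y_0\|_F)]$ with $Y(0)=Y_0$, and the following hold. 1. The spaces $F^e$ and $F^\alpha$ ($\alpha>1$) are preserved by the flow: if $Y$ is a solution on $[0,T]$, for any $T>0$, and $Y(0)\in F^e$ (resp. $F^\alpha$), then $Y(t)\in F^e$ (resp. $F^\alpha$) for all $t\in[0,T]$. 2. (Short-time solutions.) If $Y$ is a solution on $[0,T]$ with $0<T\le\tau(\|Y(0)\|_F)$, then (i) $\sup_{t\in[0,T]}\|Y(t)\|_{F^e}\le C$ if $Y(0)\in F^e$, where $C$ depends only on $\gamma$, $T$ and $\|Y(0)\|_{F^e}$; (ii) for every $\alpha>1$, $\sup_{t\in[0,T]}\|Y(t)\|_{F^\alpha}\le C$ if $Y(0)\in F^\alpha$, where $C$ depends only on $\gamma$, $\alpha$, $T$ and $\|Y(0)\|_{F^\alpha}$. 3. For a solution on any interval $[0,T]$, $T>0$, with $\sup_{t\in[0,T]}\|Y(t)\|_F\le M$, the bounds (i) and (ii) hold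 with constants that depend in addition only on $M$. -/

import Mathlib

open MeasureTheory Set
open scoped ENNReal

/-- `L^∞(ℝ)` (Lebesgue measure, real valued). -/
abbrev LInf : Type := Lp ℝ ∞ (volume : Measure ℝ)

/-- `L²(ℝ)` (Lebesgue measure, real valued). -/
abbrev LTwo : Type := Lp ℝ 2 (volume : Measure ℝ)

/-- The space `L^∞(ℝ) ∩ L²(ℝ)`: an element is given by its class in `L^∞` and its class in `L²`,
which are classes of the same function. Its topology is that of the norm
`max ‖·‖_{L^∞} ‖·‖_{L²}`. -/
def LInfCapLTwo : Submodule ℝ (LInf × LTwo) where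
  carrier := {p | (p.1 : ℝ → ℝ) =ᵐ[volume] (p.2 : ℝ → ℝ)}
  zero_mem' := by
    have h1 := Lp.coeFn_zero ℝ ∞ (volume : Measure ℝ)
    have h2 := Lp.coeFn_zero ℝ 2 (volume : Measure ℝ)
    exact h1.trans h2.symm
  add_mem' := by
    intro p q hp hq
    change (p.1 : ℝ → ℝ) =ᵐ[volume] (p.2 : ℝ → ℝ) at hp
    change (q.1 : ℝ → ℝ) =ᵐ[volume] (q.2 : ℝ → ℝ) at hq
    have h1 := Lp.coeFn_add p.1 q.1
    have h2 := Lp.coeFn_add p.2 q.2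
    exact h1.trans ((Filter.EventuallyEq.add hp hq).trans h2.symm)
  smul_mem' := by
    intro c p hp
    change (p.1 : ℝ → ℝ) =ᵐ[volume] (p.2 : ℝ → ℝ) at hp
    have h1 := Lp.coeFn_smul c p.1
    have h2 := Lp.coeFn_smul c p.2
    exact h1.trans ((Filter.EventuallyEq.const_smul hp c).trans h2.symm)

/-- The Banach space `F = L^∞ × (L^∞ ∩ L²) × L^∞ × L² × L² × L²`, with elements
`Y = (ζ, U, H, v, w, h)`. The norm that Lean puts on the product is the maximum of the norms of
the components; it is equivalent to the norm `normF` below, so that both give the same topology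
and the same `C¹` curves. -/
abbrev SpaceF : Type := LInf × LInfCapLTwo × LInf × LTwo × LTwo × LTwo

noncomputable section

namespace SpaceF

/-- The component `ζ`. -/
def zeta (Y : SpaceF) : ℝ → ℝ := Y.1

/-- The component `U`. -/
def U (Y : SpaceF) : ℝ → ℝ := Y.2.1.1.2

/-- The component `H`. -/
def H (Y : SpaceF) : ℝ → ℝ := Y.2.2.1

/-- The component `v`. -/
def v (Y : SpaceF) : ℝ → ℝ := Y.2.2.2.1

/-- The component `w`. -/
def w (Y : SpaceF) : ℝ → ℝ := Y.2.2.2.2.1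

/-- The component `h`. -/
def h (Y : SpaceF) : ℝ → ℝ := Y.2.2.2.2.2

/-- The characteristics `y(ξ) = ζ(ξ) + ξ`. -/
def y (Y : SpaceF) (ξ : ℝ) : ℝ := Y.zeta ξ + ξ

/-- `q = v + 1`. -/
def q (Y : SpaceF) (ξ : ℝ) : ℝ := Y.v ξ + 1

/-- `‖Y‖_F = ‖ζ‖_{L^∞} + ‖U‖_{L²} + ‖U‖_{L^∞} + ‖H‖_{L^∞} + ‖v‖_{L²} + ‖w‖_{L²} + ‖h‖_{L²}`. -/
def normF (Y : SpaceF) : ℝ :=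
  ‖Y.1‖ + ‖Y.2.1.1.2‖ + ‖Y.2.1.1.1‖ + ‖Y.2.2.1‖ + ‖Y.2.2.2.1‖ + ‖Y.2.2.2.2.1‖ + ‖Y.2.2.2.2.2‖

/-- The density `(3 - 2γ)/2 U² q + γ/2 h`. -/
def source (γ : ℝ) (Y : SpaceF) (η : ℝ) : ℝ :=
  (3 - 2 * γ) / 2 * (Y.U η) ^ 2 * Y.q η + γ / 2 * Y.h η

/-- The function `P`. -/
def P (γ : ℝ) (Y : SpaceF) (ξ : ℝ) : ℝ :=
  1 / 2 * ∫ η : ℝ, Real.exp (-(Real.sign (ξ - η)) * (Y.y ξ - Y.y η)) * source γ Y η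

/-- The function `Q`. -/
def Q (γ : ℝ) (Y : SpaceF) (ξ : ℝ) : ℝ :=
  -(1 / 2) * ∫ η : ℝ, Real.sign (ξ - η) *
    Real.exp (-(Real.sign (ξ - η)) * (Y.y ξ - Y.y η)) * source γ Y η

/-- `Z = G(Y)`: the element `Z` of `F` is the right-hand side, at `Y`, of the system
`ζ_t = γ U`, `U_t = -Q`, `H_t = U³ - 2PU`, `v_t = γ w`,
`w_t = γ/2 h + ((3 - 2γ)/2 U² - P) q`, `h_t = -2QUq + (3U² - 2P) w`. -/
structure IsRHS (γ : ℝ) (Y Z : SpaceF) : Prop where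
  zeta_eq : ∀ᵐ ξ : ℝ, Z.zeta ξ = γ * Y.U ξ
  U_eq : ∀ᵐ ξ : ℝ, Z.U ξ = -(Q γ Y ξ)
  H_eq : ∀ᵐ ξ : ℝ, Z.H ξ = (Y.U ξ) ^ 3 - 2 * P γ Y ξ * Y.U ξ
  v_eq : ∀ᵐ ξ : ℝ, Z.v ξ = γ * Y.w ξ
  w_eq : ∀ᵐ ξ : ℝ,
    Z.w ξ = γ / 2 * Y.h ξ + ((3 - 2 * γ) / 2 * (Y.U ξ) ^ 2 - P γ Y ξ) * Y.q ξ
  h_eq : ∀ᵐ ξ : ℝ,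
    Z.h ξ = -2 * Q γ Y ξ * Y.U ξ * Y.q ξ + (3 * (Y.U ξ) ^ 2 - 2 * P γ Y ξ) * Y.w ξ

/-- `Y` is a solution in `C¹([0,T], F)` of the Lagrangian system `Y_t = G(Y)`. (Only the values of
`Y` on `[0,T]` matter.) -/
def IsSolution (γ T : ℝ) (Y : ℝ → SpaceF) : Prop :=
  ∃ Y' : ℝ → SpaceF, ContinuousOn Y' (Icc 0 T) ∧
    ∀ t ∈ Icc 0 T, HasDerivWithinAt Y (Y' t) (Icc 0 T) t ∧ IsRHS γ (Y t) (Y' t)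

/-- Membership in the space `F^e` of exponentially decaying elements of `F`. -/
structure MemFe (Y : SpaceF) : Prop where
  q_mem : MemLp Y.q ∞
  w_mem : MemLp Y.w ∞
  h_mem : MemLp Y.h ∞
  U_decay : MemLp (fun ξ => Real.exp (|ξ| / 2) * Y.U ξ) 2
  w_decay : MemLp (fun ξ => Real.exp (|ξ| / 2) * Y.w ξ) 2
  h_decay : MemLp (fun ξ => Real.exp |ξ| * Y.h ξ) 1

/-- The norm of `F^e` (meaningful for `Y` in `F^e`). -/
def normFe (Y : SpaceF) : ℝ :=
  Y.normF + lpNorm Y.q ∞ volume + lpNorm Y.w ∞ volume + lpNorm Y.h ∞ volume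
    + lpNorm (fun ξ => Real.exp (|ξ| / 2) * Y.U ξ) 2 volume
    + lpNorm (fun ξ => Real.exp (|ξ| / 2) * Y.w ξ) 2 volume
    + lpNorm (fun ξ => Real.exp |ξ| * Y.h ξ) 1 volume

/-- Membership in the space `F^α` of polynomially decaying elements of `F`. -/
structure MemFalpha (α : ℝ) (Y : SpaceF) : Prop where
  q_mem : MemLp Y.q ∞
  w_mem : MemLp Y.w ∞
  h_mem : MemLp Y.h ∞
  U_decay : MemLp (fun ξ => (1 + |ξ|) ^ (α / 2) * Y.U ξ) 2
  w_decay : MemLp (fun ξ => (1 + |ξ|) ^ (α / 2) * Y.w ξ) 2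
  h_decay : MemLp (fun ξ => (1 + |ξ|) ^ α * Y.h ξ) 1

/-- The norm of `F^α` (meaningful for `Y` in `F^α`). -/
def normFalpha (α : ℝ) (Y : SpaceF) : ℝ :=
  Y.normF + lpNorm Y.q ∞ volume + lpNorm Y.w ∞ volume + lpNorm Y.h ∞ volume
    + lpNorm (fun ξ => (1 + |ξ|) ^ (α / 2) * Y.U ξ) 2 volume
    + lpNorm (fun ξ => (1 + |ξ|) ^ (α / 2) * Y.w ξ) 2 volume
    + lpNorm (fun ξ => (1 + |ξ|) ^ α * Y.h ξ) 1 volume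

end SpaceF

end

/-! The system is an ordinary differential equation in the Banach space `F` whose vector field is
Lipschitz on bounded sets. Off the diagonal, e^{-sgn(ξ-η)(y(ξ)-y(η))} = e^{-|ξ-η|} e^{∓(ζ(ξ)-ζ(η))}.
No monotonicity of y is needed: on each side of the diagonal, P and Q are multiplication by e^{∓ζ},
a fixed convolution with half of e^{-|x|}, and multiplication by e^{±ζ}, applied to the density. The
convolution maps L² into both L² and L^∞, and all other operations are products and exponentials of
bounded functions (`lipschitzOnBounded_vectorField`). Picard–Lindelöf then gives existence on a time
that depends only on ‖Y₀‖, and Grönwall gives uniqueness.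

Decay propagates in three stages along a solution that is bounded in `F`, so that U, P and Q are
bounded functions.

(1) At fixed ξ, the triple (q, w, h) solves a linear system with bounded coefficients, so L^∞ bounds
persist (`exists_forall_ae_abs_le`). Since the curve is differentiable only in L², Grönwall is run
in L² on sets A of finite measure; the resulting bound, proportional to |A|^{1/2} for every A, is a
pointwise bound.

(2) Let ψ be e^{|ξ|/2} or (1+|ξ|)^{α/2}. Then ψ(x) e^{-|x-y|} ≤ C ψ(y) e^{-|x-y|/2}: half of the
kernel pays for moving ψ under the integral. Hence ψP and ψQ are controlled in L² by ψ times the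
density. As q is bounded, (ψU, ψw, ψh) satisfies a closed linear Grönwall inequality in L²
(`exists_norm_weightedPart_le`). Initially ψh lies in L² because |ψh|² ≤ ‖h‖_∞ |ψ²h|.

(3) In the equation for h, apart from bounded factors, every term is a product of two of U, w, P, Q.
One ψ goes to each factor, so Cauchy–Schwarz bounds the time derivative of ψ²h in L¹, and
integration in time bounds ψ²h itself (`norm_mulLp_hL_le`).

Multiplication by ψ is not continuous on L², so (2) and (3) are carried out for bounded truncations
of ψ. The constants do not see the truncation level, and Fatou's lemma removes it
(`exists_weightedBound`). -/

open scoped NNReal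

set_option linter.unusedSectionVars false

/-! ### Calculus of maps that are Lipschitz on bounded sets. -/

section LipschitzOnBounded

variable {E F G H : Type*} [NormedAddCommGroup E] [NormedSpace ℝ E]
  [NormedAddCommGroup F] [NormedSpace ℝ F] [NormedAddCommGroup G] [NormedSpace ℝ G]
  [NormedAddCommGroup H] [NormedSpace ℝ H]

/-- A map between normed spaces that is Lipschitz on every bounded set. -/
def LipschitzOnBounded (f : E → F) : Prop :=
  ∀ R : ℝ, ∃ K : ℝ≥0, LipschitzOnWith K f (Metric.closedBall 0 R)

namespace LipschitzOnBounded

theorem exists_norm_le {f : E → F} (hf : LipschitzOnBounded f) (R : ℝ) :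
    ∃ B : ℝ, 0 ≤ B ∧ ∀ x, ‖x‖ ≤ R → ‖f x‖ ≤ B := by
  -- The absolute value keeps the origin in the ball even when `R` is negative.
  obtain ⟨K, hK⟩ := hf |R|
  refine ⟨K * |R| + ‖f 0‖, by positivity, fun x hx => ?_⟩
  have hx' : ‖x‖ ≤ |R| := hx.trans (le_abs_self R)
  have h := hK.norm_sub_le (x := x) (y := 0) (by simpa using hx') (by simp)
  rw [sub_zero] at h
  calc ‖f x‖ ≤ ‖f x - f 0‖ + ‖f 0‖ := norm_le_norm_sub_add _ _
    _ ≤ K * |R| + ‖f 0‖ := by gcongr; exact h.trans (by gcongr)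

theorem of_norm_sub_le {f : E → F}
    (h : ∀ R : ℝ, ∃ K : ℝ, ∀ x y, ‖x‖ ≤ R → ‖y‖ ≤ R → ‖f x - f y‖ ≤ K * ‖x - y‖) :
    LipschitzOnBounded f := by
  intro R
  obtain ⟨K, hK⟩ := h R
  refine ⟨K.toNNReal, LipschitzOnWith.of_dist_le_mul fun x hx y hy => ?_⟩
  rw [dist_eq_norm, dist_eq_norm]
  refine (hK x y (by simpa using hx) (by simpa using hy)).trans ?_
  gcongr
  exact Real.le_coe_toNNReal K

theorem clm (L : E →L[ℝ] F) : LipschitzOnBounded L :=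
  fun _ => ⟨‖L‖₊, L.lipschitz.lipschitzOnWith⟩

theorem const (c : F) : LipschitzOnBounded (fun _ : E => c) :=
  fun _ => ⟨0, (LipschitzWith.const c).lipschitzOnWith⟩

theorem comp {g : F → G} {f : E → F} (hg : LipschitzOnBounded g) (hf : LipschitzOnBounded f) :
    LipschitzOnBounded (fun x => g (f x)) := by
  intro R
  obtain ⟨B, -, hB⟩ := hf.exists_norm_le R
  obtain ⟨K, hK⟩ := hf R
  obtain ⟨K', hK'⟩ := hg B
  exact ⟨K' * K, hK'.comp hK fun x hx => by simpa using hB x (by simpa using hx)⟩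

theorem prodMk {f : E → F} {g : E → G} (hf : LipschitzOnBounded f) (hg : LipschitzOnBounded g) :
    LipschitzOnBounded (fun x => (f x, g x)) := by
  intro R
  obtain ⟨K, hK⟩ := hf R
  obtain ⟨K', hK'⟩ := hg R
  exact ⟨max K K', hK.prodMk hK'⟩

theorem add {f g : E → F} (hf : LipschitzOnBounded f) (hg : LipschitzOnBounded g) :
    LipschitzOnBounded (fun x => f x + g x) :=
  (clm (ContinuousLinearMap.fst ℝ F F + ContinuousLinearMap.snd ℝ F F)).comp (hf.prodMk hg)

theorem const_smul {f : E → F} (hf : LipschitzOnBounded f) (c : ℝ) :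
    LipschitzOnBounded (fun x => c • f x) :=
  (clm (c • ContinuousLinearMap.id ℝ F)).comp hf

theorem neg {f : E → F} (hf : LipschitzOnBounded f) : LipschitzOnBounded (fun x => -f x) :=
  (clm (-ContinuousLinearMap.id ℝ F)).comp hf

theorem sub {f g : E → F} (hf : LipschitzOnBounded f) (hg : LipschitzOnBounded g) :
    LipschitzOnBounded (fun x => f x - g x) :=
  (clm (ContinuousLinearMap.fst ℝ F F - ContinuousLinearMap.snd ℝ F F)).comp (hf.prodMk hg)

/-- Telescoping B(x, x') - B(y, y') leaves one increment times one bounded factor. Products are only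
Lipschitz on bounded sets, which is why this class of maps is used. -/
theorem bilin (B : F →L[ℝ] G →L[ℝ] H) {f : E → F} {g : E → G} (hf : LipschitzOnBounded f)
    (hg : LipschitzOnBounded g) : LipschitzOnBounded (fun x => B (f x) (g x)) := by
  have key : LipschitzOnBounded (fun p : F × G => B p.1 p.2) := by
    refine of_norm_sub_le fun R => ⟨‖B‖ * |R| + ‖B‖ * |R|, fun x y hx hy => ?_⟩
    have hx2 : ‖x.2‖ ≤ |R| := (norm_snd_le x).trans (hx.trans (le_abs_self R))
    have hy1 : ‖y.1‖ ≤ |R| := (norm_fst_le y).trans (hy.trans (le_abs_self R))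
    have e : B x.1 x.2 - B y.1 y.2 = B (x.1 - y.1) x.2 + B y.1 (x.2 - y.2) := by
      simp
    rw [e]
    calc ‖B (x.1 - y.1) x.2 + B y.1 (x.2 - y.2)‖
        ≤ ‖B‖ * ‖x.1 - y.1‖ * ‖x.2‖ + ‖B‖ * ‖y.1‖ * ‖x.2 - y.2‖ :=
          (norm_add_le _ _).trans (add_le_add (B.le_opNorm₂ _ _) (B.le_opNorm₂ _ _))
      _ ≤ ‖B‖ * ‖x - y‖ * |R| + ‖B‖ * |R| * ‖x - y‖ := by
          gcongr
          · exact norm_fst_le (x - y)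
          · exact norm_snd_le (x - y)
      _ = _ := by ring
  exact key.comp (hf.prodMk hg)

theorem subtype_mk {p : Submodule ℝ F} {f : E → F} (hf : LipschitzOnBounded f)
    (h : ∀ x, f x ∈ p) : LipschitzOnBounded (fun x => (⟨f x, h x⟩ : p)) := by
  intro R
  obtain ⟨K, hK⟩ := hf R
  exact ⟨K, fun x hx y hy => hK hx hy⟩

end LipschitzOnBounded

end LipschitzOnBounded

/-! ### Existence, uniqueness and Grönwall estimates for differential equations in a normed space.
-/

section ODE

variable {E : Type*} [NormedAddCommGroup E] [NormedSpace ℝ E]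

theorem HasDerivWithinAt.Ici_of_Icc_of_lt {f : ℝ → E} {f' : E} {a b t : ℝ}
    (h : HasDerivWithinAt f f' (Icc a b) t) (ht : t ∈ Ico a b) :
    HasDerivWithinAt f f' (Ici t) t :=
  (h.mono (Icc_subset_Icc_left ht.1)).mono_of_mem_nhdsWithin (Icc_mem_nhdsGE ht.2)

/-- Short-time existence, on a time interval that depends only on a bound of the initial value. -/
theorem LipschitzOnBounded.exists_solution [CompleteSpace E] {g : E → E}
    (hg : LipschitzOnBounded g) :
    ∃ τ : ℝ → ℝ, (∀ r, 0 < τ r) ∧ ∀ r x₀, ‖x₀‖ ≤ r → ∃ x : ℝ → E, x 0 = x₀ ∧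
      ∀ t ∈ Icc 0 (τ r), HasDerivWithinAt x (g (x t)) (Icc 0 (τ r)) t ∧ ‖x t‖ ≤ r + 1 := by
  choose B hB0 hB using fun r : ℝ => hg.exists_norm_le (r + 1)
  -- `B r` bounds the field on the unit ball about any starting point of norm at most r. In time
  -- 1/(B r + 1) a curve of speed at most `B r` cannot leave that ball; the added 1 avoids division
  -- by zero.
  refine ⟨fun r => 1 / (B r + 1), fun r => by have := hB0 r; positivity, fun r x₀ hx₀ => ?_⟩
  have hτ : 0 ≤ 1 / (B r + 1) := by have := hB0 r; positivity
  obtain ⟨K, hK⟩ := hg (r + 1)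
  have hball : ∀ x ∈ Metric.closedBall x₀ ((1 : ℝ≥0) : ℝ), ‖x‖ ≤ r + 1 := by
    intro x hx
    rw [mem_closedBall_iff_norm] at hx
    calc ‖x‖ ≤ ‖x - x₀‖ + ‖x₀‖ := norm_le_norm_sub_add _ _
      _ ≤ 1 + r := add_le_add hx hx₀
      _ = r + 1 := add_comm _ _
  have hm : ((B r).toNNReal : ℝ) * max (1 / (B r + 1) - 0) (0 - 0) ≤ ((1 : ℝ≥0) : ℝ) - (0 : ℝ≥0) := by
    rw [Real.coe_toNNReal _ (hB0 r), sub_zero, sub_zero, max_eq_left hτ]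
    have := hB0 r
    simp only [NNReal.coe_one, NNReal.coe_zero, sub_zero]
    rw [mul_one_div, div_le_one (by positivity)]
    linarith
  have hpl : IsPicardLindelof (fun _ => g) (⟨0, le_rfl, hτ⟩ : Icc (0 : ℝ) (1 / (B r + 1))) x₀
      1 0 (B r).toNNReal K :=
    IsPicardLindelof.of_time_independent
      (fun x hx => (hB r x (hball x hx)).trans (Real.le_coe_toNNReal _))
      (hK.mono fun x hx => by simpa using hball x hx) hm
  have hx : x₀ ∈ Metric.closedBall x₀ ((0 : ℝ≥0) : ℝ) := Metric.mem_closedBall_self le_rfl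
  -- Working with the fixed point of the Picard map itself keeps the information that its values
  -- stay in the unit ball, which yields the norm bound.
  obtain ⟨α, hα⟩ := ODE.FunSpace.exists_isFixedPt_next hpl hx
  refine ⟨α.compProj, ?_, fun t ht => ⟨?_, ?_⟩⟩
  · have h0 : α.compProj 0 = α ⟨0, le_rfl, hτ⟩ := ODE.FunSpace.compProj_of_mem ⟨le_rfl, hτ⟩
    rw [h0, ← hα, ODE.FunSpace.next_apply₀]
  · apply ODE.hasDerivWithinAt_picard_Icc (⟨le_rfl, hτ⟩ : (0 : ℝ) ∈ Icc (0 : ℝ) (1 / (B r + 1)))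
      hpl.continuousOn_uncurry
      α.continuous_compProj.continuousOn (fun _ ht' => α.compProj_mem_closedBall hpl.mul_max_le)
      x₀ ht |>.congr_of_mem _ ht
    intro t' ht'
    nth_rw 1 [← hα]
    rw [ODE.FunSpace.compProj_of_mem ht', ODE.FunSpace.next_apply]
  · exact hball _ (α.compProj_mem_closedBall hpl.mul_max_le)

theorem exists_norm_le_of_hasDerivWithinAt {x x' : ℝ → E} {T : ℝ}
    (hx : ∀ t ∈ Icc 0 T, HasDerivWithinAt x (x' t) (Icc 0 T) t) :
    ∃ R : ℝ, ∀ t ∈ Icc 0 T, ‖x t‖ ≤ R :=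
  isCompact_Icc.exists_bound_of_continuousOn fun t ht => (hx t ht).continuousWithinAt

/-- By compactness of the time interval both curves lie in one ball, on which the field has a single
Lipschitz constant. -/
theorem LipschitzOnBounded.eqOn_of_hasDerivWithinAt {g : E → E} (hg : LipschitzOnBounded g)
    {T : ℝ} {x z : ℝ → E} (hx : ∀ t ∈ Icc 0 T, HasDerivWithinAt x (g (x t)) (Icc 0 T) t)
    (hz : ∀ t ∈ Icc 0 T, HasDerivWithinAt z (g (z t)) (Icc 0 T) t) (h0 : x 0 = z 0) :
    EqOn x z (Icc 0 T) := by
  obtain ⟨R, hR⟩ := exists_norm_le_of_hasDerivWithinAt hx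
  obtain ⟨R', hR'⟩ := exists_norm_le_of_hasDerivWithinAt hz
  obtain ⟨K, hK⟩ := hg (max R R')
  refine ODE_solution_unique_of_mem_Icc_right (v := fun _ => g)
    (s := fun _ => Metric.closedBall 0 (max R R')) (fun _ _ => hK)
    (fun t ht => (hx t ht).continuousWithinAt)
    (fun t ht => (hx t (Ico_subset_Icc_self ht)).Ici_of_Icc_of_lt ht)
    (fun t ht => ?_) (fun t ht => (hz t ht).continuousWithinAt)
    (fun t ht => (hz t (Ico_subset_Icc_self ht)).Ici_of_Icc_of_lt ht) (fun t ht => ?_) h0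
  · simpa using Or.inl (hR t (Ico_subset_Icc_self ht))
  · simpa using Or.inr (hR' t (Ico_subset_Icc_self ht))

/-- Grönwall's inequality for a curve whose derivative is bounded by a multiple of its norm. -/
theorem norm_le_mul_exp_of_norm_deriv_le {T K δ : ℝ} {x x' : ℝ → E} (hK : 0 ≤ K)
    (hx : ∀ t ∈ Icc 0 T, HasDerivWithinAt x (x' t) (Icc 0 T) t)
    (hb : ∀ t ∈ Icc 0 T, ‖x' t‖ ≤ K * ‖x t‖) (h0 : ‖x 0‖ ≤ δ) :
    ∀ t ∈ Icc 0 T, ‖x t‖ ≤ δ * Real.exp (K * T) := by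
  intro t ht
  have h := norm_le_gronwallBound_of_norm_deriv_right_le (ε := 0)
    (fun t ht => (hx t ht).continuousWithinAt)
    (fun t ht => (hx t (Ico_subset_Icc_self ht)).Ici_of_Icc_of_lt ht) h0
    (fun t ht => by simpa using hb t (Ico_subset_Icc_self ht)) t ht
  rw [gronwallBound_ε0, sub_zero] at h
  have hδ : 0 ≤ δ := (norm_nonneg _).trans h0
  refine h.trans ?_
  gcongr
  exact ht.2

theorem norm_le_add_mul_of_norm_deriv_le {T B δ : ℝ} {x x' : ℝ → E} (hB : 0 ≤ B)
    (hx : ∀ t ∈ Icc 0 T, HasDerivWithinAt x (x' t) (Icc 0 T) t)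
    (hb : ∀ t ∈ Icc 0 T, ‖x' t‖ ≤ B) (h0 : ‖x 0‖ ≤ δ) :
    ∀ t ∈ Icc 0 T, ‖x t‖ ≤ δ + B * T := by
  intro t ht
  have h := norm_image_sub_le_of_norm_deriv_le_segment' hx
    (fun t ht => hb t (Ico_subset_Icc_self ht)) t ht
  have h' : ‖x t‖ ≤ ‖x t - x 0‖ + ‖x 0‖ := norm_le_norm_sub_add _ _
  have : B * (t - 0) ≤ B * T := by gcongr; linarith [ht.2]
  linarith

end ODE

/-! ### Products, domination and the exponential in Lebesgue spaces. -/

section LpTools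

variable {p q r : ℝ≥0∞} [Fact (1 ≤ p)] [Fact (1 ≤ q)] [Fact (1 ≤ r)]

/-- Pointwise multiplication `L^p × L^q → L^r` for a Hölder triple `(p, q, r)`. -/
noncomputable def mulLp (p q r : ℝ≥0∞) [Fact (1 ≤ p)] [Fact (1 ≤ q)] [Fact (1 ≤ r)]
    [ENNReal.HolderTriple p q r] : Lp ℝ p (volume : Measure ℝ) →L[ℝ]
      Lp ℝ q (volume : Measure ℝ) →L[ℝ] Lp ℝ r (volume : Measure ℝ) :=
  (ContinuousLinearMap.mul ℝ ℝ).holderL volume p q r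

theorem coeFn_mulLp [ENNReal.HolderTriple p q r] (f : Lp ℝ p (volume : Measure ℝ))
    (g : Lp ℝ q (volume : Measure ℝ)) : ∀ᵐ x, mulLp p q r f g x = f x * g x :=
  (ContinuousLinearMap.mul ℝ ℝ).coeFn_holder f g

theorem norm_mulLp_le [ENNReal.HolderTriple p q r] (f : Lp ℝ p (volume : Measure ℝ))
    (g : Lp ℝ q (volume : Measure ℝ)) : ‖mulLp p q r f g‖ ≤ ‖f‖ * ‖g‖ := by
  refine ((ContinuousLinearMap.mul ℝ ℝ).norm_holder_apply_apply_le f g).trans ?_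
  rw [mul_assoc]
  exact mul_le_of_le_one_left (by positivity) (ContinuousLinearMap.opNorm_mul_le ℝ ℝ)

theorem Lp.norm_le_add_add_of_ae_le {f g₁ g₂ g₃ : Lp ℝ p (volume : Measure ℝ)} {c₁ c₂ c₃ : ℝ}
    (h : ∀ᵐ x, |f x| ≤ c₁ * |g₁ x| + c₂ * |g₂ x| + c₃ * |g₃ x|) (h₁ : 0 ≤ c₁) (h₂ : 0 ≤ c₂)
    (h₃ : 0 ≤ c₃) : ‖f‖ ≤ c₁ * ‖g₁‖ + c₂ * ‖g₂‖ + c₃ * ‖g₃‖ := by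
  have hle : ‖f‖ ≤ ‖c₁ • |g₁| + c₂ • |g₂| + c₃ • |g₃|‖ := by
    refine Lp.norm_le_norm_of_ae_le ?_
    filter_upwards [h, Lp.coeFn_add (c₁ • |g₁| + c₂ • |g₂|) (c₃ • |g₃|),
      Lp.coeFn_add (c₁ • |g₁|) (c₂ • |g₂|), Lp.coeFn_smul c₁ |g₁|, Lp.coeFn_smul c₂ |g₂|,
      Lp.coeFn_smul c₃ |g₃|, Lp.coeFn_abs g₁, Lp.coeFn_abs g₂, Lp.coeFn_abs g₃]
      with x hx e1 e2 e3 e4 e5 e6 e7 e8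
    rw [e1, Pi.add_apply, e2, Pi.add_apply, e3, e4, e5, Pi.smul_apply, Pi.smul_apply, Pi.smul_apply,
      e6, e7, e8, Real.norm_eq_abs, smul_eq_mul, smul_eq_mul, smul_eq_mul]
    exact hx.trans (le_abs_self _)
  have hn : ∀ (c : ℝ) (g : Lp ℝ p (volume : Measure ℝ)), 0 ≤ c → ‖c • |g|‖ ≤ c * ‖g‖ := by
    intro c g hc
    rw [norm_smul, norm_abs_eq_norm, Real.norm_of_nonneg hc]
  exact hle.trans ((norm_add₃_le).trans
    (add_le_add (add_le_add (hn _ _ h₁) (hn _ _ h₂)) (hn _ _ h₃)))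

theorem Lp.norm_le_add_of_ae_le {f g₁ g₂ : Lp ℝ p (volume : Measure ℝ)} {c₁ c₂ : ℝ}
    (h : ∀ᵐ x, |f x| ≤ c₁ * |g₁ x| + c₂ * |g₂ x|) (h₁ : 0 ≤ c₁) (h₂ : 0 ≤ c₂) :
    ‖f‖ ≤ c₁ * ‖g₁‖ + c₂ * ‖g₂‖ := by
  simpa using Lp.norm_le_add_add_of_ae_le (g₃ := 0) (c₃ := 0)
    (h.mono fun x hx => by simpa using hx) h₁ h₂ le_rfl

theorem Lp.ae_abs_le_norm (f : Lp ℝ ∞ (volume : Measure ℝ)) : ∀ᵐ x, |f x| ≤ ‖f‖ := by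
  have h := ae_le_lpNorm_exponent_top (Lp.memLp f)
  rwa [← toReal_eLpNorm (Lp.aestronglyMeasurable f)] at h

theorem eLpNorm_top_le_of_ae_abs_le {f : ℝ → ℝ} {C : ℝ} (h : ∀ᵐ x, |f x| ≤ C) :
    eLpNorm f ∞ volume ≤ ENNReal.ofReal C := by
  rw [eLpNorm_exponent_top]
  exact eLpNormEssSup_le_of_ae_bound h

theorem Lp.norm_le_of_ae_abs_le {f : Lp ℝ ∞ (volume : Measure ℝ)} {C : ℝ} (hC : 0 ≤ C)
    (h : ∀ᵐ x, |f x| ≤ C) : ‖f‖ ≤ C := by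
  rw [Lp.norm_def]
  exact ENNReal.toReal_le_of_le_ofReal hC (eLpNorm_top_le_of_ae_abs_le h)

theorem eLpNorm_two_sq {α : Type*} [MeasurableSpace α] {ε : Type*} [TopologicalSpace ε]
    [ContinuousENorm ε] (f : α → ε) (μ : Measure α) :
    eLpNorm f 2 μ ^ 2 = ∫⁻ x, ‖f x‖ₑ ^ 2 ∂μ := by
  have h := eLpNorm_nnreal_pow_eq_lintegral (μ := μ) (f := f) (p := 2) (by norm_num)
  simpa using h

theorem lpNorm_le_of_eLpNorm_le {f : ℝ → ℝ} {C : ℝ} (hC : 0 ≤ C)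
    (h : eLpNorm f p volume ≤ ENNReal.ofReal C) : lpNorm f p volume ≤ C := by
  by_cases hf : AEStronglyMeasurable f volume
  · rw [← toReal_eLpNorm hf]
    exact ENNReal.toReal_le_of_le_ofReal hC h
  · rwa [lpNorm_of_not_aestronglyMeasurable hf]

/-- A function whose `L²` norm on every set of finite measure is that of a function bounded by `c`
is bounded by `c`. -/
theorem ae_abs_le_of_forall_eLpNorm_indicator_le {f : ℝ → ℝ} (hf : AEStronglyMeasurable f volume)
    {c : ℝ} (hc : 0 ≤ c)
    (h : ∀ A, MeasurableSet A → volume A < ∞ →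
      eLpNorm (A.indicator f) 2 volume ≤ ENNReal.ofReal c * eLpNorm (A.indicator 1 : ℝ → ℝ) 2 volume) :
    ∀ᵐ x, |f x| ≤ c := by
  -- Squared, the hypothesis says that the integral of f² over each A of finite measure is at most
  -- that of c², and such a comparison of integrals passes to the integrands.
  have key : (fun x => ‖f x‖ₑ ^ 2) ≤ᵐ[volume] fun _ => ENNReal.ofReal c ^ 2 := by
    refine ae_le_of_forall_setLIntegral_le_of_sigmaFinite₀ (hf.enorm.pow_const 2) fun A hA hA' => ?_
    have h2 := pow_le_pow_left' (h A hA hA') 2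
    rw [mul_pow, eLpNorm_two_sq, eLpNorm_two_sq] at h2
    have e1 : ∫⁻ x, ‖A.indicator f x‖ₑ ^ 2 = ∫⁻ x in A, ‖f x‖ₑ ^ 2 := by
      rw [← lintegral_indicator hA]
      refine lintegral_congr fun x => ?_
      by_cases hx : x ∈ A <;> simp [hx]
    have e2 : ∫⁻ x, ‖(A.indicator 1 : ℝ → ℝ) x‖ₑ ^ 2 = volume A := by
      rw [← lintegral_indicator_one hA]
      refine lintegral_congr fun x => ?_
      by_cases hx : x ∈ A <;> simp [hx]
    rw [e1, e2] at h2
    rwa [setLIntegral_const]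
  filter_upwards [key] with x hx
  rw [← ENNReal.ofReal_le_ofReal_iff hc, ← Real.norm_eq_abs, ofReal_norm]
  exact (ENNReal.pow_le_pow_left_iff two_ne_zero).1 hx

/-- Fatou's lemma for an increasing sequence of weights. -/
theorem eLpNorm_le_of_forall_of_tendsto {f : ℝ → ℝ} {F : ℕ → ℝ → ℝ} {C : ℝ≥0∞}
    (hF : ∀ n, AEStronglyMeasurable (F n) volume)
    (hlim : ∀ᵐ x, Filter.Tendsto (fun n => F n x) Filter.atTop (nhds (f x)))
    (h : ∀ n, eLpNorm (F n) p volume ≤ C) : eLpNorm f p volume ≤ C := by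
  refine (Lp.eLpNorm_lim_le_liminf_eLpNorm hF f hlim).trans ?_
  exact (Filter.liminf_le_liminf (Filter.Eventually.of_forall h)).trans (by simp)

theorem memLp_exp (f : LInf) : MemLp (fun x => Real.exp (f x)) ∞ (volume : Measure ℝ) := by
  refine memLp_top_of_bound
    (Real.continuous_exp.comp_aestronglyMeasurable (Lp.aestronglyMeasurable f)) (Real.exp ‖f‖) ?_
  filter_upwards [Lp.ae_abs_le_norm f] with x hx
  rw [Real.norm_eq_abs, Real.abs_exp]
  exact Real.exp_le_exp.2 ((le_abs_self _).trans hx)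

/-- The exponential on `L^∞`. -/
noncomputable def expLInf (f : LInf) : LInf := (memLp_exp f).toLp

theorem coeFn_expLInf (f : LInf) : ∀ᵐ x, expLInf f x = Real.exp (f x) :=
  (memLp_exp f).coeFn_toLp

theorem Real.abs_exp_sub_exp_le {a b R : ℝ} (ha : a ≤ R) (hb : b ≤ R) :
    |Real.exp a - Real.exp b| ≤ Real.exp R * |a - b| := by
  refine Convex.norm_image_sub_le_of_norm_deriv_le (s := Iic R) (f := Real.exp)
    (fun x _ => Real.differentiableAt_exp) (fun x hx => ?_) (convex_Iic R) hb ha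
  rw [Real.deriv_exp, Real.norm_eq_abs, Real.abs_exp]
  exact Real.exp_le_exp.2 hx

theorem lipschitzOnBounded_expLInf : LipschitzOnBounded expLInf := by
  refine LipschitzOnBounded.of_norm_sub_le fun R => ⟨Real.exp R, fun f g hf hg => ?_⟩
  refine Lp.norm_le_of_ae_abs_le (by positivity) ?_
  filter_upwards [coeFn_expLInf f, coeFn_expLInf g, Lp.coeFn_sub (expLInf f) (expLInf g),
    Lp.coeFn_sub f g, Lp.ae_abs_le_norm f, Lp.ae_abs_le_norm g, Lp.ae_abs_le_norm (f - g)]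
    with x e1 e2 e3 e4 h1 h2 h3
  rw [e3, Pi.sub_apply, e1, e2]
  rw [e4, Pi.sub_apply] at h3
  exact (Real.abs_exp_sub_exp_le ((le_abs_self _).trans (h1.trans hf))
    ((le_abs_self _).trans (h2.trans hg))).trans (by gcongr)

end LpTools

/-! ### Convolution with exponentially decaying kernels. -/

section Kernel

/-- The convolution of `e^{-a|x|}` with a nonnegative function. -/
noncomputable def expConv (a : ℝ) (g : ℝ → ℝ≥0∞) (x : ℝ) : ℝ≥0∞ :=
  ∫⁻ y, ENNReal.ofReal (Real.exp (-(a * |x - y|))) * g y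

/-- The integral of `e^{-a|x|}`. -/
noncomputable def expMass (a : ℝ) : ℝ≥0∞ := ∫⁻ x : ℝ, ENNReal.ofReal (Real.exp (-(a * |x|)))

theorem expMass_lt_top {a : ℝ} (ha : 0 < a) : expMass a < ∞ := by
  have h : Integrable (fun x : ℝ => Real.exp (-(a * |x|))) volume := by
    rw [← integrableOn_univ, ← Iic_union_Ioi (a := (0 : ℝ))]
    refine IntegrableOn.union ?_ ?_
    · refine (integrableOn_exp_mul_Iic ha 0).congr_fun (fun x hx => ?_) measurableSet_Iic
      simp only [abs_of_nonpos (mem_Iic.1 hx)]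
      congr 1; ring
    · refine (integrableOn_exp_mul_Ioi (neg_lt_zero.2 ha) 0).congr_fun (fun x hx => ?_)
        measurableSet_Ioi
      simp only [abs_of_pos (mem_Ioi.1 hx)]
      congr 1; ring
  exact h.lintegral_lt_top

theorem measurable_expKernel (a : ℝ) :
    Measurable fun p : ℝ × ℝ => ENNReal.ofReal (Real.exp (-(a * |p.1 - p.2|))) := by
  fun_prop

theorem aemeasurable_expConv (a : ℝ) {g : ℝ → ℝ≥0∞} (hg : AEMeasurable g volume) :
    AEMeasurable (expConv a g) volume := by
  have h : AEMeasurable (fun p : ℝ × ℝ =>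
      ENNReal.ofReal (Real.exp (-(a * |p.1 - p.2|))) * g p.2) (volume.prod volume) :=
    (measurable_expKernel a).aemeasurable.mul
      (hg.comp_quasiMeasurePreserving Measure.quasiMeasurePreserving_snd)
  exact h.lintegral_prod_right'

theorem lintegral_expKernel_right (a x : ℝ) :
    ∫⁻ y : ℝ, ENNReal.ofReal (Real.exp (-(a * |x - y|))) = expMass a :=
  lintegral_sub_left_eq_self (fun z : ℝ => ENNReal.ofReal (Real.exp (-(a * |z|)))) x

theorem lintegral_expKernel_left (a y : ℝ) :
    ∫⁻ x : ℝ, ENNReal.ofReal (Real.exp (-(a * |x - y|))) = expMass a :=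
  lintegral_sub_right_eq_self (fun z : ℝ => ENNReal.ofReal (Real.exp (-(a * |z|)))) y

/-- Cauchy–Schwarz for the measure k dμ, obtained by writing k = k^{1/2} k^{1/2}. With values in [0,
∞] no integrability is required. -/
theorem lintegral_mul_sq_le {α : Type*} [MeasurableSpace α] {μ : Measure α} {k g : α → ℝ≥0∞}
    (hk : AEMeasurable k μ) (hg : AEMeasurable g μ) :
    (∫⁻ x, k x * g x ∂μ) ^ 2 ≤ (∫⁻ x, k x ∂μ) * ∫⁻ x, k x * g x ^ 2 ∂μ := by
  have h := ENNReal.lintegral_mul_le_Lp_mul_Lq μ Real.HolderConjugate.two_two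
    (f := fun x => k x ^ (1 / 2 : ℝ)) (g := fun x => k x ^ (1 / 2 : ℝ) * g x)
    (hk.pow_const _) ((hk.pow_const _).mul hg)
  have hs : ∀ z : ℝ≥0∞, (z ^ (1 / 2 : ℝ)) ^ (2 : ℝ) = z := fun z => by
    rw [← ENNReal.rpow_mul]; norm_num
  have hs' : ∀ z : ℝ≥0∞, (z ^ (1 / 2 : ℝ)) ^ 2 = z := fun z => by
    rw [← ENNReal.rpow_two, hs]
  have e1 : ∀ x, k x ^ (1 / 2 : ℝ) * (k x ^ (1 / 2 : ℝ) * g x) = k x * g x := fun x => by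
    rw [← mul_assoc, ← sq, hs']
  have e2 : ∀ x, (k x ^ (1 / 2 : ℝ) * g x) ^ (2 : ℝ) = k x * g x ^ 2 := fun x => by
    rw [ENNReal.rpow_two, mul_pow, hs']
  simp only [Pi.mul_apply, e1, e2, hs] at h
  calc (∫⁻ x, k x * g x ∂μ) ^ 2
      ≤ ((∫⁻ x, k x ∂μ) ^ (1 / 2 : ℝ) * (∫⁻ x, k x * g x ^ 2 ∂μ) ^ (1 / 2 : ℝ)) ^ 2 := by gcongr
    _ = _ := by rw [mul_pow, hs', hs']

theorem expConv_sq_le (a x : ℝ) {g : ℝ → ℝ≥0∞} (hg : AEMeasurable g volume) :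
    expConv a g x ^ 2 ≤ expMass a * expConv a (fun y => g y ^ 2) x := by
  have h := lintegral_mul_sq_le (μ := (volume : Measure ℝ))
    (k := fun y => ENNReal.ofReal (Real.exp (-(a * |x - y|)))) (by fun_prop) hg
  rwa [lintegral_expKernel_right] at h

theorem expConv_sq_le_lintegral {a : ℝ} (ha : 0 ≤ a) (x : ℝ) {g : ℝ → ℝ≥0∞}
    (hg : AEMeasurable g volume) : expConv a g x ^ 2 ≤ expMass a * ∫⁻ y, g y ^ 2 := by
  refine (expConv_sq_le a x hg).trans ?_
  gcongr
  refine lintegral_mono fun y => mul_le_of_le_one_left zero_le ?_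
  rw [ENNReal.ofReal_le_one, Real.exp_le_one_iff]
  have := abs_nonneg (x - y)
  nlinarith

/-- Young's inequality for the convolution of `e^{-a|x|}` with a square integrable function. -/
theorem lintegral_expConv_sq_le (a : ℝ) {g : ℝ → ℝ≥0∞} (hg : AEMeasurable g volume) :
    ∫⁻ x, expConv a g x ^ 2 ≤ expMass a ^ 2 * ∫⁻ y, g y ^ 2 := by
  have hg2 : AEMeasurable (fun y => g y ^ 2) volume := hg.pow_const 2
  have hm : AEMeasurable (Function.uncurry fun x y : ℝ =>
      ENNReal.ofReal (Real.exp (-(a * |x - y|))) * g y ^ 2) (volume.prod volume) :=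
    (measurable_expKernel a).aemeasurable.mul
      (hg2.comp_quasiMeasurePreserving Measure.quasiMeasurePreserving_snd)
  calc ∫⁻ x, expConv a g x ^ 2 ≤ ∫⁻ x, expMass a * expConv a (fun y => g y ^ 2) x :=
        lintegral_mono fun x => expConv_sq_le a x hg
    _ = expMass a * ∫⁻ x, expConv a (fun y => g y ^ 2) x :=
        lintegral_const_mul'' _ (aemeasurable_expConv a hg2)
    _ = expMass a * ∫⁻ y, ∫⁻ x, ENNReal.ofReal (Real.exp (-(a * |x - y|))) * g y ^ 2 := by
        rw [← lintegral_lintegral_swap hm]; rfl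
    _ = expMass a * ∫⁻ y, expMass a * g y ^ 2 := by
        congr 1
        refine lintegral_congr fun y => ?_
        rw [lintegral_mul_const _ (by fun_prop), lintegral_expKernel_left]
    _ = _ := by rw [lintegral_const_mul'' _ hg2, sq, mul_assoc]

theorem eLpNorm_two_expConv_le (a : ℝ) {f : ℝ → ℝ} (hf : AEStronglyMeasurable f volume) :
    eLpNorm (expConv a fun y => ‖f y‖ₑ) 2 volume ≤ expMass a * eLpNorm f 2 volume := by
  rw [← ENNReal.pow_le_pow_left_iff two_ne_zero, mul_pow, eLpNorm_two_sq, eLpNorm_two_sq]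
  simpa using lintegral_expConv_sq_le a hf.enorm

/-- The same Cauchy–Schwarz estimate, now with the remaining kernel bounded by 1. The bound holds at
every point and also makes the potentials converge everywhere. -/
theorem expConv_le_eLpNorm_two {a : ℝ} (ha : 0 ≤ a) {f : ℝ → ℝ}
    (hf : AEStronglyMeasurable f volume) (x : ℝ) :
    expConv a (fun y => ‖f y‖ₑ) x ≤ expMass a ^ (1 / 2 : ℝ) * eLpNorm f 2 volume := by
  have e : (expMass a ^ (1 / 2 : ℝ)) ^ 2 = expMass a := by
    rw [← ENNReal.rpow_two, ← ENNReal.rpow_mul]; norm_num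
  rw [← ENNReal.pow_le_pow_left_iff two_ne_zero, mul_pow, eLpNorm_two_sq, e]
  exact expConv_sq_le_lintegral ha x hf.enorm

theorem eLpNorm_top_expConv_le {a : ℝ} (ha : 0 ≤ a) {f : ℝ → ℝ}
    (hf : AEStronglyMeasurable f volume) :
    eLpNorm (expConv a fun y => ‖f y‖ₑ) ∞ volume ≤
      expMass a ^ (1 / 2 : ℝ) * eLpNorm f 2 volume := by
  rw [eLpNorm_exponent_top]
  exact eLpNormEssSup_le_of_ae_enorm_bound
    (Filter.Eventually.of_forall fun x => by simpa using expConv_le_eLpNorm_two ha hf x)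

/-- A measurable convolution kernel dominated by `e^{-|x|}`. -/
structure IsExpKernel (k : ℝ → ℝ) : Prop where
  measurable : Measurable k
  abs_le : ∀ x, |k x| ≤ Real.exp (-|x|)

namespace IsExpKernel

variable {k : ℝ → ℝ} (hk : IsExpKernel k)
include hk

theorem enorm_mul_le (x y : ℝ) (c : ℝ) :
    ‖k (x - y) * c‖ₑ ≤ ENNReal.ofReal (Real.exp (-(1 * |x - y|))) * ‖c‖ₑ := by
  rw [enorm_mul, one_mul, ← ofReal_norm (k (x - y)), Real.norm_eq_abs]
  gcongr
  exact hk.abs_le _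

theorem integrable_mul {f : ℝ → ℝ} (hf : MemLp f 2 volume) (x : ℝ) :
    Integrable (fun y => k (x - y) * f y) volume := by
  refine ⟨((hk.measurable.comp (by fun_prop)).aestronglyMeasurable).mul hf.1, ?_⟩
  refine (lintegral_mono fun y => hk.enorm_mul_le x y (f y)).trans_lt ?_
  refine (expConv_le_eLpNorm_two zero_le_one hf.1 x).trans_lt ?_
  exact ENNReal.mul_lt_top (ENNReal.rpow_lt_top_of_nonneg (by norm_num)
    (expMass_lt_top one_pos).ne) hf.2

theorem enorm_integral_le (f : ℝ → ℝ) (x : ℝ) :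
    ‖∫ y, k (x - y) * f y‖ₑ ≤ expConv 1 (fun y => ‖f y‖ₑ) x :=
  (enorm_integral_le_lintegral_enorm _).trans (lintegral_mono fun y => hk.enorm_mul_le x y (f y))

theorem aestronglyMeasurable_integral {f : ℝ → ℝ} (hf : AEStronglyMeasurable f volume) :
    AEStronglyMeasurable (fun x => ∫ y, k (x - y) * f y) volume := by
  have h : AEStronglyMeasurable (fun p : ℝ × ℝ => k (p.1 - p.2) * f p.2) (volume.prod volume) :=
    ((hk.measurable.comp (by fun_prop)).aestronglyMeasurable).mul
      (hf.comp_quasiMeasurePreserving Measure.quasiMeasurePreserving_snd)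
  exact h.integral_prod_right'

/-- The exponent stays abstract because P and Q are needed both in L² and in L^∞; only the bound
`hC` differs between the two cases. -/
theorem memLp_integral {p : ℝ≥0∞} {C : ℝ≥0} (hC : ∀ f : LTwo,
      eLpNorm (expConv 1 fun y => ‖f y‖ₑ) p volume ≤ C * eLpNorm f 2 volume) (f : LTwo) :
    MemLp (fun x => ∫ y, k (x - y) * f y) p volume := by
  refine ⟨hk.aestronglyMeasurable_integral (Lp.aestronglyMeasurable f), ?_⟩
  refine (eLpNorm_mono_enorm fun x => ?_).trans_lt ((hC f).trans_lt
    (ENNReal.mul_lt_top ENNReal.coe_lt_top (Lp.eLpNorm_lt_top f)))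
  simpa using hk.enorm_integral_le f x

end IsExpKernel

/-- Convolution with a kernel dominated by `e^{-|x|}`, as an operator from `L²` to `L^p`. -/
noncomputable def expKernelOp {k : ℝ → ℝ} (hk : IsExpKernel k) (p : ℝ≥0∞) [Fact (1 ≤ p)] (C : ℝ≥0)
    (hC : ∀ f : LTwo, eLpNorm (expConv 1 fun y => ‖f y‖ₑ) p volume ≤ C * eLpNorm f 2 volume) :
    LTwo →L[ℝ] Lp ℝ p (volume : Measure ℝ) :=
  LinearMap.mkContinuous
    { toFun := fun f => (hk.memLp_integral hC f).toLp
      map_add' := fun f g => by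
        rw [← MemLp.toLp_add]
        refine MemLp.toLp_congr _ _ (Filter.Eventually.of_forall fun x => ?_)
        simp only [Pi.add_apply]
        rw [← integral_add (hk.integrable_mul (Lp.memLp f) x) (hk.integrable_mul (Lp.memLp g) x)]
        refine integral_congr_ae ?_
        filter_upwards [Lp.coeFn_add f g] with y hy
        rw [hy, Pi.add_apply, mul_add]
      map_smul' := fun c f => by
        rw [RingHom.id_apply, ← MemLp.toLp_const_smul]
        refine MemLp.toLp_congr _ _ (Filter.Eventually.of_forall fun x => ?_)
        simp only [Pi.smul_apply, smul_eq_mul]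
        rw [← integral_const_mul]
        refine integral_congr_ae ?_
        filter_upwards [Lp.coeFn_smul c f] with y hy
        rw [hy, Pi.smul_apply, smul_eq_mul]
        ring } C fun f => by
    simp only [LinearMap.coe_mk, AddHom.coe_mk]
    rw [Lp.norm_toLp, Lp.norm_def, ← ENNReal.coe_toReal, ← ENNReal.toReal_mul]
    refine ENNReal.toReal_mono (ENNReal.mul_ne_top ENNReal.coe_ne_top (Lp.eLpNorm_ne_top f)) ?_
    refine (eLpNorm_mono_enorm fun x => ?_).trans (hC f)
    simpa using hk.enorm_integral_le f x

theorem coeFn_expKernelOp {k : ℝ → ℝ} (hk : IsExpKernel k) (p : ℝ≥0∞) [Fact (1 ≤ p)] (C : ℝ≥0)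
    (hC : ∀ f : LTwo, eLpNorm (expConv 1 fun y => ‖f y‖ₑ) p volume ≤ C * eLpNorm f 2 volume)
    (f : LTwo) : ∀ᵐ x, expKernelOp hk p C hC f x = ∫ y, k (x - y) * f y :=
  (hk.memLp_integral hC f).coeFn_toLp

theorem eLpNorm_two_expConv_one_le (f : LTwo) :
    eLpNorm (expConv 1 fun y => ‖f y‖ₑ) 2 volume ≤ (expMass 1).toNNReal * eLpNorm f 2 volume := by
  rw [ENNReal.coe_toNNReal (expMass_lt_top one_pos).ne]
  exact eLpNorm_two_expConv_le 1 (Lp.aestronglyMeasurable f)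

theorem eLpNorm_top_expConv_one_le (f : LTwo) :
    eLpNorm (expConv 1 fun y => ‖f y‖ₑ) ∞ volume ≤
      (expMass 1 ^ (1 / 2 : ℝ)).toNNReal * eLpNorm f 2 volume := by
  rw [ENNReal.coe_toNNReal (ENNReal.rpow_lt_top_of_nonneg (by norm_num)
    (expMass_lt_top one_pos).ne).ne]
  exact eLpNorm_top_expConv_le zero_le_one (Lp.aestronglyMeasurable f)

/-- Applied to the two half lines, since the factor e^{±ζ} in the kernel of P and Q changes across
the diagonal. -/
theorem isExpKernel_indicator {s : Set ℝ} (hs : MeasurableSet s) :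
    IsExpKernel (s.indicator fun x => Real.exp (-|x|)) where
  measurable := Measurable.indicator (by fun_prop) hs
  abs_le x := by
    by_cases hx : x ∈ s <;> simp [hx, Real.exp_nonneg]

end Kernel

/-! ### The Lagrangian system as a vector field on `F`. -/

noncomputable section

/-- A Gaussian g lies in L² ∩ L^∞ and vanishes nowhere, so two classes agree a.e. exactly when their
products with g agree in L². This is an equality of continuous maps, hence a closed condition in a
complete product. -/
instance : CompleteSpace LInfCapLTwo := by
  have hg : Integrable (fun x : ℝ => Real.exp (-x ^ 2)) volume := by
    simpa using integrable_exp_neg_mul_sq one_pos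
  have hbound : ∀ x : ℝ, ‖Real.exp (-x ^ 2)‖ ≤ 1 := fun x => by
    rw [Real.norm_eq_abs, Real.abs_exp, Real.exp_le_one_iff]
    nlinarith [sq_nonneg x]
  have hgm : AEStronglyMeasurable (fun x : ℝ => Real.exp (-x ^ 2)) volume := hg.1
  have htop : MemLp (fun x : ℝ => Real.exp (-x ^ 2)) ∞ volume :=
    memLp_top_of_bound hgm 1 (Filter.Eventually.of_forall hbound)
  have htwo : MemLp (fun x : ℝ => Real.exp (-x ^ 2)) 2 volume := by
    refine (memLp_two_iff_integrable_sq hgm).2 ?_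
    refine (integrable_exp_neg_mul_sq (two_pos)).congr (Filter.Eventually.of_forall fun x => ?_)
    simp only [sq (Real.exp _), ← Real.exp_add]
    congr 1; ring
  have hclosed : IsClosed (LInfCapLTwo : Set (LInf × LTwo)) := by
    have : (LInfCapLTwo : Set (LInf × LTwo)) =
        {p | mulLp ∞ 2 2 p.1 htwo.toLp = mulLp ∞ 2 2 htop.toLp p.2} := by
      ext p
      have h1 := coeFn_mulLp (r := 2) p.1 htwo.toLp
      have h2 := coeFn_mulLp (r := 2) htop.toLp p.2
      change (p.1 : ℝ → ℝ) =ᵐ[volume] (p.2 : ℝ → ℝ) ↔ _ = _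
      constructor
      · intro h
        refine Lp.ext ?_
        filter_upwards [h, h1, h2, htwo.coeFn_toLp, htop.coeFn_toLp] with x hx e1 e2 e3 e4
        rw [e1, e2, e3, e4, hx, mul_comm]
      · intro h
        rw [h] at h1
        filter_upwards [h1, h2, htwo.coeFn_toLp, htop.coeFn_toLp] with x e1 e2 e3 e4
        rw [e1, e3, e4, mul_comm] at e2
        exact mul_left_cancel₀ (Real.exp_ne_zero _) e2
    rw [this]
    exact isClosed_eq (by fun_prop) (by fun_prop)
  exact hclosed.completeSpace_coe

namespace SpaceF

/-! ### The components as continuous linear maps -/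

def zetaL : SpaceF →L[ℝ] LInf := ContinuousLinearMap.fst ℝ _ _

/-- Having U both in L^∞ and in L² lets each product be placed in the Lebesgue space where it is
needed. -/
def UTop : SpaceF →L[ℝ] LInf :=
  (ContinuousLinearMap.fst ℝ LInf LTwo).comp (LInfCapLTwo.subtypeL.comp
    ((ContinuousLinearMap.fst ℝ _ _).comp (ContinuousLinearMap.snd ℝ _ _)))

def UTwo : SpaceF →L[ℝ] LTwo :=
  (ContinuousLinearMap.snd ℝ LInf LTwo).comp (LInfCapLTwo.subtypeL.comp
    ((ContinuousLinearMap.fst ℝ _ _).comp (ContinuousLinearMap.snd ℝ _ _)))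

def vL : SpaceF →L[ℝ] LTwo :=
  (ContinuousLinearMap.fst ℝ _ _).comp ((ContinuousLinearMap.snd ℝ _ _).comp
    ((ContinuousLinearMap.snd ℝ _ _).comp (ContinuousLinearMap.snd ℝ _ _)))

def wL : SpaceF →L[ℝ] LTwo :=
  (ContinuousLinearMap.fst ℝ _ _).comp ((ContinuousLinearMap.snd ℝ _ _).comp
    ((ContinuousLinearMap.snd ℝ _ _).comp ((ContinuousLinearMap.snd ℝ _ _).comp
      (ContinuousLinearMap.snd ℝ _ _))))

def hL : SpaceF →L[ℝ] LTwo :=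
  (ContinuousLinearMap.snd ℝ _ _).comp ((ContinuousLinearMap.snd ℝ _ _).comp
    ((ContinuousLinearMap.snd ℝ _ _).comp ((ContinuousLinearMap.snd ℝ _ _).comp
      (ContinuousLinearMap.snd ℝ _ _))))

theorem coeFn_UTop (Y : SpaceF) : ∀ᵐ x, UTop Y x = Y.U x := Y.2.1.2

theorem coeFn_UTwo (Y : SpaceF) : ⇑(UTwo Y) = Y.U := rfl
theorem coeFn_zetaL (Y : SpaceF) : ⇑(zetaL Y) = Y.zeta := rfl
theorem coeFn_vL (Y : SpaceF) : ⇑(vL Y) = Y.v := rfl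
theorem coeFn_wL (Y : SpaceF) : ⇑(wL Y) = Y.w := rfl
theorem coeFn_hL (Y : SpaceF) : ⇑(hL Y) = Y.h := rfl

/-- `U²` as an element of `L^∞`. -/
def USq (Y : SpaceF) : LInf := mulLp ∞ ∞ ∞ (UTop Y) (UTop Y)

theorem coeFn_USq (Y : SpaceF) : ∀ᵐ x, USq Y x = Y.U x ^ 2 := by
  filter_upwards [coeFn_mulLp (r := ∞) (UTop Y) (UTop Y), coeFn_UTop Y] with x e1 e2
  rw [USq, e1, e2, sq]

theorem lipschitzOnBounded_USq : LipschitzOnBounded USq :=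
  .bilin _ (.clm _) (.clm _)

/-- The density `(3 - 2γ)/2 U² q + γ/2 h` as an element of `L²`. -/
def sourceTwo (γ : ℝ) (Y : SpaceF) : LTwo :=
  -- Here U²q is expanded as U·U + U²·v, because q = v + 1 itself is not in L².
  ((3 - 2 * γ) / 2) • (mulLp ∞ 2 2 (UTop Y) (UTwo Y) + mulLp ∞ 2 2 (USq Y) (vL Y))
    + (γ / 2) • hL Y

theorem coeFn_sourceTwo (γ : ℝ) (Y : SpaceF) : ∀ᵐ x, sourceTwo γ Y x = source γ Y x := by
  have e1 := Lp.coeFn_add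
    (((3 - 2 * γ) / 2) • (mulLp ∞ 2 2 (UTop Y) (UTwo Y) + mulLp ∞ 2 2 (USq Y) (vL Y)))
    ((γ / 2) • hL Y)
  filter_upwards [e1, Lp.coeFn_smul ((3 - 2 * γ) / 2)
      (mulLp ∞ 2 2 (UTop Y) (UTwo Y) + mulLp ∞ 2 2 (USq Y) (vL Y)),
    Lp.coeFn_smul (γ / 2) (hL Y),
    Lp.coeFn_add (mulLp ∞ 2 2 (UTop Y) (UTwo Y)) (mulLp ∞ 2 2 (USq Y) (vL Y)),
    coeFn_mulLp (r := 2) (UTop Y) (UTwo Y), coeFn_mulLp (r := 2) (USq Y) (vL Y),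
    coeFn_USq Y, coeFn_UTop Y] with x e1 e2 e3 e4 e5 e6 e7 e8
  rw [sourceTwo, e1, Pi.add_apply, e2, e3, Pi.smul_apply, Pi.smul_apply, e4, Pi.add_apply, e5, e6,
    e7, e8, coeFn_UTwo, coeFn_vL, coeFn_hL, source, q, smul_eq_mul, smul_eq_mul]
  ring

theorem lipschitzOnBounded_sourceTwo (γ : ℝ) : LipschitzOnBounded (sourceTwo γ) :=
  .add (.const_smul (.add (.bilin _ (.clm _) (.clm _))
    (.bilin _ lipschitzOnBounded_USq (.clm _))) _) (.const_smul (.clm _) _)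

/-! ### The potentials -/

section Potential

variable (p : ℝ≥0∞) [Fact (1 ≤ p)] (C : ℝ≥0)
  (hC : ∀ f : LTwo, eLpNorm (expConv 1 fun y => ‖f y‖ₑ) p volume ≤ C * eLpNorm f 2 volume)

/-- The operator `f ↦ e^{-sζ} k * (e^{sζ} f)` for a kernel `k` dominated by `e^{-|x|}`, applied to
the density of `Y`. -/
def halfPotential {k : ℝ → ℝ} (hk : IsExpKernel k) (s γ : ℝ) (Y : SpaceF) :
    Lp ℝ p (volume : Measure ℝ) :=
  mulLp ∞ p p (expLInf ((-s) • zetaL Y))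
    (expKernelOp hk p C hC (mulLp ∞ 2 2 (expLInf (s • zetaL Y)) (sourceTwo γ Y)))

theorem lipschitzOnBounded_halfPotential {k : ℝ → ℝ} (hk : IsExpKernel k) (s γ : ℝ) :
    LipschitzOnBounded (halfPotential p C hC hk s γ) :=
  .bilin _ (lipschitzOnBounded_expLInf.comp (.const_smul (.clm _) _))
    ((LipschitzOnBounded.clm _).comp (.bilin _
      (lipschitzOnBounded_expLInf.comp (.const_smul (.clm _) _)) (lipschitzOnBounded_sourceTwo γ)))

theorem ae_exp_mul_sourceTwo (s γ : ℝ) (Y : SpaceF) :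
    ∀ᵐ y, mulLp ∞ 2 2 (expLInf (s • zetaL Y)) (sourceTwo γ Y) y
      = Real.exp (s * Y.zeta y) * source γ Y y := by
  filter_upwards [coeFn_mulLp (r := 2) (expLInf (s • zetaL Y)) (sourceTwo γ Y),
    coeFn_expLInf (s • zetaL Y), Lp.coeFn_smul s (zetaL Y), coeFn_sourceTwo γ Y] with y e1 e2 e3 e4
  rw [e1, e2, e3, e4, Pi.smul_apply, smul_eq_mul, coeFn_zetaL]

theorem integrable_kernel_mul_source {k : ℝ → ℝ} (hk : IsExpKernel k) (s γ : ℝ) (Y : SpaceF)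
    (x : ℝ) : Integrable (fun y => k (x - y) * (Real.exp (s * Y.zeta y) * source γ Y y)) volume := by
  refine (hk.integrable_mul (Lp.memLp (mulLp ∞ 2 2 (expLInf (s • zetaL Y)) (sourceTwo γ Y)))
    x).congr ?_
  filter_upwards [ae_exp_mul_sourceTwo s γ Y] with y hy
  rw [hy]

theorem coeFn_halfPotential {k : ℝ → ℝ} (hk : IsExpKernel k) (s γ : ℝ) (Y : SpaceF) :
    ∀ᵐ x, halfPotential p C hC hk s γ Y x = Real.exp (-s * Y.zeta x) *
      ∫ y, k (x - y) * (Real.exp (s * Y.zeta y) * source γ Y y) := by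
  filter_upwards [coeFn_mulLp (r := p) (expLInf ((-s) • zetaL Y))
      (expKernelOp hk p C hC (mulLp ∞ 2 2 (expLInf (s • zetaL Y)) (sourceTwo γ Y))),
    coeFn_expLInf ((-s) • zetaL Y), Lp.coeFn_smul (-s) (zetaL Y),
    coeFn_expKernelOp hk p C hC (mulLp ∞ 2 2 (expLInf (s • zetaL Y)) (sourceTwo γ Y))]
    with x e1 e2 e3 e4
  rw [halfPotential, e1, e2, e3, e4, Pi.smul_apply, smul_eq_mul, coeFn_zetaL]
  congr 1
  refine integral_congr_ae ?_
  filter_upwards [ae_exp_mul_sourceTwo s γ Y] with y hy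
  rw [hy]

theorem isExpKernel_right : IsExpKernel ((Ioi 0).indicator fun x => Real.exp (-|x|)) :=
  isExpKernel_indicator measurableSet_Ioi

theorem isExpKernel_left : IsExpKernel ((Iio 0).indicator fun x => Real.exp (-|x|)) :=
  isExpKernel_indicator measurableSet_Iio

/-- `P` as an element of `L^p`, for `p = 2` and `p = ∞`. -/
def PLp (γ : ℝ) (Y : SpaceF) : Lp ℝ p (volume : Measure ℝ) :=
  (1 / 2 : ℝ) • (halfPotential p C hC isExpKernel_right 1 γ Y
    + halfPotential p C hC isExpKernel_left (-1) γ Y)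

/-- `Q` as an element of `L^p`, for `p = 2` and `p = ∞`. -/
def QLp (γ : ℝ) (Y : SpaceF) : Lp ℝ p (volume : Measure ℝ) :=
  (-(1 / 2) : ℝ) • (halfPotential p C hC isExpKernel_right 1 γ Y
    - halfPotential p C hC isExpKernel_left (-1) γ Y)

theorem lipschitzOnBounded_PLp (γ : ℝ) : LipschitzOnBounded (PLp p C hC γ) :=
  .const_smul (.add (lipschitzOnBounded_halfPotential p C hC _ _ _)
    (lipschitzOnBounded_halfPotential p C hC _ _ _)) _

theorem lipschitzOnBounded_QLp (γ : ℝ) : LipschitzOnBounded (QLp p C hC γ) :=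
  .const_smul (.sub (lipschitzOnBounded_halfPotential p C hC _ _ _)
    (lipschitzOnBounded_halfPotential p C hC _ _ _)) _

/-- The kernel of `P` splits into its parts on the two sides of the diagonal. -/
theorem exp_sign_mul_eq (Y : SpaceF) {x y : ℝ} (hxy : y ≠ x) (c : ℝ) :
    Real.exp (-(Real.sign (x - y)) * (Y.y x - Y.y y)) * c =
      Real.exp (-1 * Y.zeta x) * ((Ioi 0).indicator (fun x => Real.exp (-|x|)) (x - y) *
        (Real.exp (1 * Y.zeta y) * c)) +
      Real.exp (- -1 * Y.zeta x) * ((Iio 0).indicator (fun x => Real.exp (-|x|)) (x - y) *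
        (Real.exp (-1 * Y.zeta y) * c)) := by
  rcases lt_or_gt_of_ne hxy with h | h
  · have h1 : x - y ∈ Ioi (0 : ℝ) := sub_pos.2 h
    have h2 : x - y ∉ Iio (0 : ℝ) := fun h' => lt_asymm (mem_Iio.1 h') h1
    rw [indicator_of_mem h1, indicator_of_notMem h2, Real.sign_of_pos h1,
      abs_of_pos (mem_Ioi.1 h1), zero_mul, mul_zero, add_zero, ← mul_assoc, ← mul_assoc,
      ← Real.exp_add, ← Real.exp_add, SpaceF.y, SpaceF.y]
    congr 2; ring
  · have h1 : x - y ∈ Iio (0 : ℝ) := sub_neg.2 h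
    have h2 : x - y ∉ Ioi (0 : ℝ) := fun h' => lt_asymm (mem_Iio.1 h1) h'
    rw [indicator_of_mem h1, indicator_of_notMem h2, Real.sign_of_neg h1,
      abs_of_neg (mem_Iio.1 h1), zero_mul, mul_zero, zero_add, ← mul_assoc, ← mul_assoc,
      ← Real.exp_add, ← Real.exp_add, SpaceF.y, SpaceF.y]
    congr 2; ring

theorem sign_mul_exp_sign_mul_eq (Y : SpaceF) {x y : ℝ} (hxy : y ≠ x) (c : ℝ) :
    Real.sign (x - y) * Real.exp (-(Real.sign (x - y)) * (Y.y x - Y.y y)) * c =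
      Real.exp (-1 * Y.zeta x) * ((Ioi 0).indicator (fun x => Real.exp (-|x|)) (x - y) *
        (Real.exp (1 * Y.zeta y) * c)) -
      Real.exp (- -1 * Y.zeta x) * ((Iio 0).indicator (fun x => Real.exp (-|x|)) (x - y) *
        (Real.exp (-1 * Y.zeta y) * c)) := by
  rw [mul_assoc, exp_sign_mul_eq Y hxy]
  rcases lt_or_gt_of_ne hxy with h | h
  · have h1 : x - y ∈ Ioi (0 : ℝ) := sub_pos.2 h
    have h2 : x - y ∉ Iio (0 : ℝ) := fun h' => lt_asymm (mem_Iio.1 h') h1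
    rw [indicator_of_notMem h2, Real.sign_of_pos h1]
    ring
  · have h1 : x - y ∈ Iio (0 : ℝ) := sub_neg.2 h
    have h2 : x - y ∉ Ioi (0 : ℝ) := fun h' => lt_asymm (mem_Iio.1 h1) h'
    rw [indicator_of_notMem h2, Real.sign_of_neg h1]
    ring

theorem ae_ne (x : ℝ) : ∀ᵐ y : ℝ, y ≠ x := Measure.ae_ne volume x

theorem P_eq (γ : ℝ) (Y : SpaceF) (x : ℝ) : P γ Y x = 1 / 2 *
    (Real.exp (-1 * Y.zeta x) * (∫ y, (Ioi 0).indicator (fun x => Real.exp (-|x|)) (x - y) *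
        (Real.exp (1 * Y.zeta y) * source γ Y y)) +
      Real.exp (- -1 * Y.zeta x) * ∫ y, (Iio 0).indicator (fun x => Real.exp (-|x|)) (x - y) *
        (Real.exp (-1 * Y.zeta y) * source γ Y y)) := by
  rw [P, ← integral_const_mul (Real.exp (-1 * Y.zeta x)),
    ← integral_const_mul (Real.exp (- -1 * Y.zeta x)), ← integral_add
    ((integrable_kernel_mul_source isExpKernel_right 1 γ Y x).const_mul _)
    ((integrable_kernel_mul_source isExpKernel_left (-1) γ Y x).const_mul _)]
  congr 1
  refine integral_congr_ae ?_
  -- On the diagonal the sign is 0 and both half-line kernels vanish, so the splitting fails there,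
  -- but only on a null set.
  filter_upwards [ae_ne x] with y hy using exp_sign_mul_eq Y hy _

theorem Q_eq (γ : ℝ) (Y : SpaceF) (x : ℝ) : Q γ Y x = -(1 / 2) *
    (Real.exp (-1 * Y.zeta x) * (∫ y, (Ioi 0).indicator (fun x => Real.exp (-|x|)) (x - y) *
        (Real.exp (1 * Y.zeta y) * source γ Y y)) -
      Real.exp (- -1 * Y.zeta x) * ∫ y, (Iio 0).indicator (fun x => Real.exp (-|x|)) (x - y) *
        (Real.exp (-1 * Y.zeta y) * source γ Y y)) := by
  rw [Q, ← integral_const_mul (Real.exp (-1 * Y.zeta x)),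
    ← integral_const_mul (Real.exp (- -1 * Y.zeta x)), ← integral_sub
    ((integrable_kernel_mul_source isExpKernel_right 1 γ Y x).const_mul _)
    ((integrable_kernel_mul_source isExpKernel_left (-1) γ Y x).const_mul _)]
  congr 1
  refine integral_congr_ae ?_
  filter_upwards [ae_ne x] with y hy using sign_mul_exp_sign_mul_eq Y hy _

theorem coeFn_PLp (γ : ℝ) (Y : SpaceF) : ∀ᵐ x, PLp p C hC γ Y x = P γ Y x := by
  have e0 := Lp.coeFn_smul (1 / 2 : ℝ) (halfPotential p C hC isExpKernel_right 1 γ Y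
    + halfPotential p C hC isExpKernel_left (-1) γ Y)
  filter_upwards [e0, Lp.coeFn_add (halfPotential p C hC isExpKernel_right 1 γ Y)
    (halfPotential p C hC isExpKernel_left (-1) γ Y),
    coeFn_halfPotential p C hC isExpKernel_right 1 γ Y,
    coeFn_halfPotential p C hC isExpKernel_left (-1) γ Y] with x e1 e2 e3 e4
  rw [PLp, e1, Pi.smul_apply, e2, Pi.add_apply, e3, e4, P_eq, smul_eq_mul]

theorem coeFn_QLp (γ : ℝ) (Y : SpaceF) : ∀ᵐ x, QLp p C hC γ Y x = Q γ Y x := by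
  have e0 := Lp.coeFn_smul (-(1 / 2) : ℝ) (halfPotential p C hC isExpKernel_right 1 γ Y
    - halfPotential p C hC isExpKernel_left (-1) γ Y)
  filter_upwards [e0, Lp.coeFn_sub (halfPotential p C hC isExpKernel_right 1 γ Y)
    (halfPotential p C hC isExpKernel_left (-1) γ Y),
    coeFn_halfPotential p C hC isExpKernel_right 1 γ Y,
    coeFn_halfPotential p C hC isExpKernel_left (-1) γ Y] with x e1 e2 e3 e4
  rw [QLp, e1, Pi.smul_apply, e2, Pi.sub_apply, e3, e4, Q_eq, smul_eq_mul]

end Potential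

/-- `P` as an element of `L²`. -/
def PTwo : ℝ → SpaceF → LTwo := PLp 2 _ eLpNorm_two_expConv_one_le

/-- `Q` as an element of `L²`. -/
def QTwo : ℝ → SpaceF → LTwo := QLp 2 _ eLpNorm_two_expConv_one_le

/-- `P` as an element of `L^∞`. -/
def PTop : ℝ → SpaceF → LInf := PLp ∞ _ eLpNorm_top_expConv_one_le

/-- `Q` as an element of `L^∞`. -/
def QTop : ℝ → SpaceF → LInf := QLp ∞ _ eLpNorm_top_expConv_one_le

theorem coeFn_PTwo (γ : ℝ) (Y : SpaceF) : ∀ᵐ x, PTwo γ Y x = P γ Y x := coeFn_PLp _ _ _ γ Y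
theorem coeFn_QTwo (γ : ℝ) (Y : SpaceF) : ∀ᵐ x, QTwo γ Y x = Q γ Y x := coeFn_QLp _ _ _ γ Y
theorem coeFn_PTop (γ : ℝ) (Y : SpaceF) : ∀ᵐ x, PTop γ Y x = P γ Y x := coeFn_PLp _ _ _ γ Y
theorem coeFn_QTop (γ : ℝ) (Y : SpaceF) : ∀ᵐ x, QTop γ Y x = Q γ Y x := coeFn_QLp _ _ _ γ Y

/-! ### The right-hand side of the system -/

def velocity (γ : ℝ) (Y : SpaceF) : LInfCapLTwo :=
  ⟨(-QTop γ Y, -QTwo γ Y), by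
    change (⇑(-QTop γ Y) : ℝ → ℝ) =ᵐ[volume] ⇑(-QTwo γ Y)
    filter_upwards [Lp.coeFn_neg (QTop γ Y), Lp.coeFn_neg (QTwo γ Y), coeFn_QTop γ Y,
      coeFn_QTwo γ Y] with x e1 e2 e3 e4
    rw [e1, e2, Pi.neg_apply, Pi.neg_apply, e3, e4]⟩

def HRate (γ : ℝ) (Y : SpaceF) : LInf :=
  mulLp ∞ ∞ ∞ (USq Y + (-2 : ℝ) • PTop γ Y) (UTop Y)

/-- With q = v + 1, the part with v is bounded times L², while the part with 1 requires U² and P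
themselves in L². This is where the L² bound of P enters. -/
def wRate (γ : ℝ) (Y : SpaceF) : LTwo :=
  (γ / 2) • hL Y + (mulLp ∞ 2 2 (((3 - 2 * γ) / 2) • USq Y - PTop γ Y) (vL Y)
    + (((3 - 2 * γ) / 2) • mulLp ∞ 2 2 (UTop Y) (UTwo Y) - PTwo γ Y))

def hRate (γ : ℝ) (Y : SpaceF) : LTwo :=
  (-2 : ℝ) • (mulLp ∞ 2 2 (QTop γ Y) (UTwo Y) + mulLp ∞ 2 2 (mulLp ∞ ∞ ∞ (QTop γ Y) (UTop Y)) (vL Y))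
    + mulLp ∞ 2 2 ((3 : ℝ) • USq Y - (2 : ℝ) • PTop γ Y) (wL Y)

/-- The right-hand side of the system as a map of `F` into itself. -/
def vectorField (γ : ℝ) (Y : SpaceF) : SpaceF :=
  (γ • UTop Y, velocity γ Y, HRate γ Y, γ • wL Y, wRate γ Y, hRate γ Y)

theorem lipschitzOnBounded_vectorField (γ : ℝ) : LipschitzOnBounded (vectorField γ) := by
  have hP2 : LipschitzOnBounded (PTwo γ) := lipschitzOnBounded_PLp _ _ _ γ
  have hQ2 : LipschitzOnBounded (QTwo γ) := lipschitzOnBounded_QLp _ _ _ γ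
  have hP : LipschitzOnBounded (PTop γ) := lipschitzOnBounded_PLp _ _ _ γ
  have hQ : LipschitzOnBounded (QTop γ) := lipschitzOnBounded_QLp _ _ _ γ
  have hU := lipschitzOnBounded_USq
  refine .prodMk (.const_smul (.clm _) _) (.prodMk ?_ (.prodMk ?_ (.prodMk
    (.const_smul (.clm _) _) (.prodMk ?_ ?_))))
  · exact LipschitzOnBounded.subtype_mk (.prodMk hQ.neg hQ2.neg) fun Y => (velocity γ Y).2
  · exact .bilin _ (hU.add (hP.const_smul _)) (.clm _)
  · exact .add (.const_smul (.clm _) _) (.add (.bilin _ ((hU.const_smul _).sub hP) (.clm _))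
      (.sub (.const_smul (.bilin _ (.clm _) (.clm _)) _) hP2))
  · exact .add (.const_smul (.add (.bilin _ hQ (.clm _))
      (.bilin _ (.bilin _ hQ (.clm _)) (.clm _))) _)
      (.bilin _ ((hU.const_smul _).sub (hP.const_smul _)) (.clm _))

theorem coeFn_wRate (γ : ℝ) (Y : SpaceF) : ∀ᵐ ξ, wRate γ Y ξ =
    γ / 2 * Y.h ξ + ((3 - 2 * γ) / 2 * (Y.U ξ) ^ 2 - P γ Y ξ) * Y.q ξ := by
  have e0 := Lp.coeFn_add ((γ / 2) • hL Y)
    (mulLp ∞ 2 2 (((3 - 2 * γ) / 2) • USq Y - PTop γ Y) (vL Y)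
    + (((3 - 2 * γ) / 2) • mulLp ∞ 2 2 (UTop Y) (UTwo Y) - PTwo γ Y))
  have e1 := Lp.coeFn_add (mulLp ∞ 2 2 (((3 - 2 * γ) / 2) • USq Y - PTop γ Y) (vL Y))
    (((3 - 2 * γ) / 2) • mulLp ∞ 2 2 (UTop Y) (UTwo Y) - PTwo γ Y)
  have e2 := coeFn_mulLp (r := 2) (((3 - 2 * γ) / 2) • USq Y - PTop γ Y) (vL Y)
  have e3 := Lp.coeFn_sub (((3 - 2 * γ) / 2) • USq Y) (PTop γ Y)
  have e4 := Lp.coeFn_sub (((3 - 2 * γ) / 2) • mulLp ∞ 2 2 (UTop Y) (UTwo Y)) (PTwo γ Y)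
  filter_upwards [e0, e1, e2, e3, e4, Lp.coeFn_smul (γ / 2) (hL Y),
    Lp.coeFn_smul ((3 - 2 * γ) / 2) (USq Y),
    Lp.coeFn_smul ((3 - 2 * γ) / 2) (mulLp ∞ 2 2 (UTop Y) (UTwo Y)),
    coeFn_mulLp (r := 2) (UTop Y) (UTwo Y), coeFn_USq Y, coeFn_UTop Y, coeFn_PTop γ Y,
    coeFn_PTwo γ Y] with x e0 e1 e2 e3 e4 e5 e6 e7 e8 e9 f1 f2 f3
  rw [wRate, e0, Pi.add_apply, e1, Pi.add_apply, e2, e3, Pi.sub_apply, e4, Pi.sub_apply, e5, e6, e7,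
    Pi.smul_apply, Pi.smul_apply, Pi.smul_apply, e8, e9, f1, f2, f3, smul_eq_mul, smul_eq_mul,
    smul_eq_mul, coeFn_hL, coeFn_vL, coeFn_UTwo, q]
  ring

theorem coeFn_hRate (γ : ℝ) (Y : SpaceF) : ∀ᵐ ξ, hRate γ Y ξ =
    -2 * Q γ Y ξ * Y.U ξ * Y.q ξ + (3 * (Y.U ξ) ^ 2 - 2 * P γ Y ξ) * Y.w ξ := by
  have e0 := Lp.coeFn_add ((-2 : ℝ) • (mulLp ∞ 2 2 (QTop γ Y) (UTwo Y)
    + mulLp ∞ 2 2 (mulLp ∞ ∞ ∞ (QTop γ Y) (UTop Y)) (vL Y)))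
    (mulLp ∞ 2 2 ((3 : ℝ) • USq Y - (2 : ℝ) • PTop γ Y) (wL Y))
  have e1 := Lp.coeFn_smul (-2 : ℝ) (mulLp ∞ 2 2 (QTop γ Y) (UTwo Y)
    + mulLp ∞ 2 2 (mulLp ∞ ∞ ∞ (QTop γ Y) (UTop Y)) (vL Y))
  have e2 := Lp.coeFn_add (mulLp ∞ 2 2 (QTop γ Y) (UTwo Y))
    (mulLp ∞ 2 2 (mulLp ∞ ∞ ∞ (QTop γ Y) (UTop Y)) (vL Y))
  have e3 := coeFn_mulLp (r := 2) ((3 : ℝ) • USq Y - (2 : ℝ) • PTop γ Y) (wL Y)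
  have e4 := Lp.coeFn_sub ((3 : ℝ) • USq Y) ((2 : ℝ) • PTop γ Y)
  filter_upwards [e0, e1, e2, e3, e4, Lp.coeFn_smul (3 : ℝ) (USq Y),
    Lp.coeFn_smul (2 : ℝ) (PTop γ Y), coeFn_mulLp (r := 2) (QTop γ Y) (UTwo Y),
    coeFn_mulLp (r := 2) (mulLp ∞ ∞ ∞ (QTop γ Y) (UTop Y)) (vL Y),
    coeFn_mulLp (r := ∞) (QTop γ Y) (UTop Y), coeFn_USq Y, coeFn_UTop Y, coeFn_PTop γ Y,
    coeFn_QTop γ Y] with x e0 e1 e2 e3 e4 e5 e6 e7 e8 e9 f1 f2 f3 f4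
  rw [hRate, e0, Pi.add_apply, e1, Pi.smul_apply, e2, Pi.add_apply, e3, e4, Pi.sub_apply, e5, e6,
    Pi.smul_apply, Pi.smul_apply, e7, e8, e9, f1, f2, f3, f4, smul_eq_mul, smul_eq_mul,
    smul_eq_mul, coeFn_wL, coeFn_vL, coeFn_UTwo, q]
  ring

theorem isRHS_vectorField (γ : ℝ) (Y : SpaceF) : IsRHS γ Y (vectorField γ Y) where
  zeta_eq := by
    filter_upwards [Lp.coeFn_smul γ (UTop Y), coeFn_UTop Y] with x e1 e2
    change (γ • UTop Y : LInf) x = _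
    rw [e1, Pi.smul_apply, e2, smul_eq_mul]
  U_eq := by
    filter_upwards [Lp.coeFn_neg (QTwo γ Y), coeFn_QTwo γ Y] with x e1 e2
    change (-QTwo γ Y : LTwo) x = _
    rw [e1, Pi.neg_apply, e2]
  H_eq := by
    filter_upwards [coeFn_mulLp (r := ∞) (USq Y + (-2 : ℝ) • PTop γ Y) (UTop Y),
      Lp.coeFn_add (USq Y) ((-2 : ℝ) • PTop γ Y), Lp.coeFn_smul (-2 : ℝ) (PTop γ Y), coeFn_USq Y,
      coeFn_PTop γ Y, coeFn_UTop Y] with x e1 e2 e3 e4 e5 e6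
    change HRate γ Y x = _
    rw [HRate, e1, e2, Pi.add_apply, e3, Pi.smul_apply, e4, e5, e6, smul_eq_mul]
    ring
  v_eq := Lp.coeFn_smul γ (wL Y)
  w_eq := coeFn_wRate γ Y
  h_eq := coeFn_hRate γ Y

/-- Identifies the derivative of any solution with `vectorField`, so that the abstract theory of
differential equations applies. -/
theorem IsRHS.eq {γ : ℝ} {Y Z Z' : SpaceF} (h : IsRHS γ Y Z) (h' : IsRHS γ Y Z') : Z = Z' := by
  have ext2 : ∀ {p : ℝ≥0∞} {f g : Lp ℝ p (volume : Measure ℝ)} {φ : ℝ → ℝ},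
      (∀ᵐ x, f x = φ x) → (∀ᵐ x, g x = φ x) → f = g := fun hf hg =>
    Lp.ext (by filter_upwards [hf, hg] with x e1 e2; rw [e1, e2])
  have hU : Z.2.1.1.2 = Z'.2.1.1.2 := ext2 h.U_eq h'.U_eq
  have hU' : Z.2.1.1.1 = Z'.2.1.1.1 := Lp.ext (by
    filter_upwards [coeFn_UTop Z, coeFn_UTop Z', h.U_eq, h'.U_eq] with x e1 e2 e3 e4
    exact (e1.trans e3).trans (e2.trans e4).symm)
  exact Prod.ext (ext2 h.zeta_eq h'.zeta_eq) (Prod.ext (Subtype.ext (Prod.ext hU' hU))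
    (Prod.ext (ext2 h.H_eq h'.H_eq) (Prod.ext (ext2 h.v_eq h'.v_eq)
      (Prod.ext (ext2 h.w_eq h'.w_eq) (ext2 h.h_eq h'.h_eq)))))

theorem IsSolution.hasDerivWithinAt {γ T : ℝ} {Y : ℝ → SpaceF} (hY : IsSolution γ T Y) :
    ∀ t ∈ Icc 0 T, HasDerivWithinAt Y (vectorField γ (Y t)) (Icc 0 T) t := by
  obtain ⟨Y', -, h⟩ := hY
  intro t ht
  rw [← (h t ht).2.eq (isRHS_vectorField γ (Y t))]
  exact (h t ht).1

/-- Continuity of the derivative is automatic: the curve is bounded and the field is Lipschitz on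
bounded sets. -/
theorem isSolution_of_hasDerivWithinAt {γ T : ℝ} {Y : ℝ → SpaceF}
    (hY : ∀ t ∈ Icc 0 T, HasDerivWithinAt Y (vectorField γ (Y t)) (Icc 0 T) t) :
    IsSolution γ T Y := by
  refine ⟨fun t => vectorField γ (Y t), ?_, fun t ht => ⟨hY t ht, isRHS_vectorField γ (Y t)⟩⟩
  obtain ⟨R, hR⟩ := exists_norm_le_of_hasDerivWithinAt hY
  obtain ⟨K, hK⟩ := lipschitzOnBounded_vectorField γ R
  exact hK.continuousOn.comp (fun t ht => (hY t ht).continuousWithinAt)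
    fun t ht => by simpa using hR t ht

theorem norm_le_normF (Y : SpaceF) : ‖Y‖ ≤ Y.normF := by
  have h1 := norm_nonneg Y.1
  have h2 := norm_nonneg Y.2.1.1.2
  have h3 := norm_nonneg Y.2.1.1.1
  have h4 := norm_nonneg Y.2.2.1
  have h5 := norm_nonneg Y.2.2.2.1
  have h6 := norm_nonneg Y.2.2.2.2.1
  have h7 := norm_nonneg Y.2.2.2.2.2
  have hU : ‖Y.2.1‖ = max ‖Y.2.1.1.1‖ ‖Y.2.1.1.2‖ := rfl
  rw [normF, Prod.norm_def, Prod.norm_def (x := Y.2), hU, Prod.norm_def (x := Y.2.2),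
    Prod.norm_def (x := Y.2.2.2), Prod.norm_def (x := Y.2.2.2.2)]
  simp only [max_le_iff]
  refine ⟨?_, ⟨?_, ?_⟩, ?_, ?_, ?_, ?_⟩ <;> linarith

theorem normF_le (Y : SpaceF) : Y.normF ≤ 7 * ‖Y‖ := by
  have h1 := norm_fst_le Y
  have h2 := norm_snd_le Y
  have h3 := norm_fst_le Y.2
  have h4 := norm_snd_le Y.2
  have hU : ‖Y.2.1‖ = max ‖Y.2.1.1.1‖ ‖Y.2.1.1.2‖ := rfl
  have h5 : ‖Y.2.1.1.1‖ ≤ ‖Y.2.1‖ := hU ▸ le_max_left _ _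
  have h6 : ‖Y.2.1.1.2‖ ≤ ‖Y.2.1‖ := hU ▸ le_max_right _ _
  have h7 := norm_fst_le Y.2.2
  have h8 := norm_snd_le Y.2.2
  have h9 := norm_fst_le Y.2.2.2
  have h10 := norm_snd_le Y.2.2.2
  have h11 := norm_fst_le Y.2.2.2.2
  have h12 := norm_snd_le Y.2.2.2.2
  rw [normF]
  linarith

end SpaceF

end

/-! ### Admissible weights, and the potentials in weighted L². -/

noncomputable section

/-- A nonnegative weight that grows at most like `e^{|x|/2}`, in the form in which this is needed to
commute it with the convolution with `e^{-|x|}`. -/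
structure IsExpWeight (ψ : ℝ → ℝ) (C : ℝ) : Prop where
  measurable : Measurable ψ
  nonneg : ∀ x, 0 ≤ ψ x
  one_le : 1 ≤ C
  mul_exp_le : ∀ x y, ψ x * Real.exp (-|x - y|) ≤ C * (ψ y * Real.exp (-(1 / 2 * |x - y|)))

namespace IsExpWeight

variable {ψ : ℝ → ℝ} {C : ℝ}

/-- The constant is the same for every n, which makes all later estimates uniform in the truncation.
Where the cut acts at y, the inequality reduces to 1 ≤ C. -/
theorem truncate (hψ : IsExpWeight ψ C) (n : ℕ) : IsExpWeight (fun x => min (ψ x) n) C where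
  measurable := hψ.measurable.min measurable_const
  nonneg x := le_min (hψ.nonneg x) n.cast_nonneg
  one_le := hψ.one_le
  mul_exp_le x y := by
    rcases le_total (ψ y) n with h | h
    · rw [min_eq_left h]
      refine le_trans ?_ (hψ.mul_exp_le x y)
      gcongr
      exact min_le_left _ _
    · rw [min_eq_right h]
      calc min (ψ x) (n : ℝ) * Real.exp (-|x - y|)
          ≤ n * Real.exp (-(1 / 2 * |x - y|)) := by
            gcongr
            · exact min_le_right _ _
            · linarith [abs_nonneg (x - y)]
        _ ≤ C * (n * Real.exp (-(1 / 2 * |x - y|))) :=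
            le_mul_of_one_le_left (by positivity) hψ.one_le

theorem memLp_truncate (hψ : IsExpWeight ψ C) (n : ℕ) :
    MemLp (fun x => min (ψ x) n) ∞ (volume : Measure ℝ) :=
  memLp_top_of_bound (hψ.truncate n).measurable.aestronglyMeasurable n
    (Filter.Eventually.of_forall fun x => by
      rw [Real.norm_of_nonneg ((hψ.truncate n).nonneg x)]
      exact min_le_right _ _)

end IsExpWeight

theorem tendsto_min_natCast (a : ℝ) :
    Filter.Tendsto (fun n : ℕ => min a n) Filter.atTop (nhds a) := by
  refine tendsto_const_nhds.congr' ?_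
  filter_upwards [Filter.eventually_ge_atTop ⌈a⌉₊] with n hn
  rw [min_eq_left ((Nat.le_ceil a).trans (by exact_mod_cast hn))]

namespace SpaceF

/-! ### Pointwise bounds of the coefficients -/

theorem ae_abs_zeta_le (Y : SpaceF) : ∀ᵐ x, |Y.zeta x| ≤ ‖Y‖ := by
  filter_upwards [Lp.ae_abs_le_norm (zetaL Y)] with x hx
  exact hx.trans (norm_fst_le Y)

theorem exists_coefficient_bound (γ M : ℝ) :
    ∃ B : ℝ, 0 ≤ B ∧ ∀ Y : SpaceF, ‖Y‖ ≤ M → ∀ᵐ x, |Y.U x| ≤ B ∧ |P γ Y x| ≤ B ∧ |Q γ Y x| ≤ B := by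
  obtain ⟨B₁, h₁, hB₁⟩ := (LipschitzOnBounded.clm UTop).exists_norm_le M
  obtain ⟨B₂, h₂, hB₂⟩ := LipschitzOnBounded.exists_norm_le
    (f := PTop γ) (lipschitzOnBounded_PLp _ _ _ γ) M
  obtain ⟨B₃, h₃, hB₃⟩ := LipschitzOnBounded.exists_norm_le
    (f := QTop γ) (lipschitzOnBounded_QLp _ _ _ γ) M
  refine ⟨B₁ + B₂ + B₃, by positivity, fun Y hY => ?_⟩
  filter_upwards [Lp.ae_abs_le_norm (UTop Y), Lp.ae_abs_le_norm (PTop γ Y),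
    Lp.ae_abs_le_norm (QTop γ Y), coeFn_UTop Y, coeFn_PTop γ Y, coeFn_QTop γ Y]
    with x i1 i2 i3 e1 e2 e3
  rw [e1] at i1
  rw [e2] at i2
  rw [e3] at i3
  have := hB₁ Y hY
  have := hB₂ Y hY
  have := hB₃ Y hY
  exact ⟨by linarith, by linarith, by linarith⟩

/-! ### Weighted bounds of the potentials -/

/-- The exponent differs from -|x - y| by at most |ζ(x)| + |ζ(y)|. -/
theorem exp_sign_le {Y : SpaceF} {M x y : ℝ} (hx : |Y.zeta x| ≤ M) (hy : |Y.zeta y| ≤ M) :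
    Real.exp (-(Real.sign (x - y)) * (Y.y x - Y.y y)) ≤
      Real.exp (2 * M) * Real.exp (-|x - y|) := by
  rw [← Real.exp_add, Real.exp_le_exp, SpaceF.y, SpaceF.y]
  have h1 := abs_le.1 hx
  have h2 := abs_le.1 hy
  rcases lt_trichotomy (x - y) 0 with h | h | h
  · rw [Real.sign_of_neg h, abs_of_neg h]; linarith
  · rw [h, Real.sign_zero, abs_zero]; linarith
  · rw [Real.sign_of_pos h, abs_of_pos h]; linarith

theorem abs_sign_le_one (x : ℝ) : |Real.sign x| ≤ 1 := by
  rcases Real.sign_apply_eq x with h | h | h <;> simp [h]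

/-- Moves the weight from outside the integral onto the density, at the cost of half of the decay
rate. Here `c` stands for the prefactor ±1/2 of P and Q. -/
theorem enorm_mul_integral_le {ψ : ℝ → ℝ} {C : ℝ} (hψ : IsExpWeight ψ C) {f G : ℝ → ℝ}
    {A c x : ℝ} (hA : 0 ≤ A) (hc : |c| ≤ 1)
    (hG : ∀ᵐ y, |G y| ≤ A * Real.exp (-|x - y|) * |f y|) :
    ‖ψ x * (c * ∫ y, G y)‖ₑ ≤ ENNReal.ofReal (A * C) * expConv (1 / 2) (fun y => ‖ψ y * f y‖ₑ) x := by
  have hc' : ‖c‖ₑ ≤ 1 := by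
    rw [← ofReal_norm, Real.norm_eq_abs]
    exact ENNReal.ofReal_le_one.2 hc
  calc ‖ψ x * (c * ∫ y, G y)‖ₑ ≤ ‖ψ x‖ₑ * (1 * ∫⁻ y, ‖G y‖ₑ) := by
        rw [enorm_mul, enorm_mul]
        gcongr
        exact enorm_integral_le_lintegral_enorm _
    _ = ∫⁻ y, ‖ψ x‖ₑ * ‖G y‖ₑ := by
        rw [one_mul, lintegral_const_mul' _ _ enorm_ne_top]
    _ ≤ ∫⁻ y, ENNReal.ofReal (A * C) *
          (ENNReal.ofReal (Real.exp (-(1 / 2 * |x - y|))) * ‖ψ y * f y‖ₑ) := by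
        refine lintegral_mono_ae ?_
        filter_upwards [hG] with y hy
        rw [← enorm_mul, ← ofReal_norm, ← ofReal_norm, ← ENNReal.ofReal_mul (Real.exp_nonneg _),
          ← ENNReal.ofReal_mul (mul_nonneg hA (zero_le_one.trans hψ.one_le))]
        refine ENNReal.ofReal_le_ofReal ?_
        rw [norm_mul, norm_mul, Real.norm_of_nonneg (hψ.nonneg x), Real.norm_of_nonneg (hψ.nonneg y),
          Real.norm_eq_abs, Real.norm_eq_abs]
        calc ψ x * |G y| ≤ ψ x * (A * Real.exp (-|x - y|) * |f y|) :=
              mul_le_mul_of_nonneg_left hy (hψ.nonneg x)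
          _ = A * |f y| * (ψ x * Real.exp (-|x - y|)) := by ring
          _ ≤ A * |f y| * (C * (ψ y * Real.exp (-(1 / 2 * |x - y|)))) :=
              mul_le_mul_of_nonneg_left (hψ.mul_exp_le x y) (by positivity)
          _ = _ := by ring
    _ = _ := by rw [lintegral_const_mul' _ _ ENNReal.ofReal_ne_top, expConv]

section WeightedPotential

variable {ψ : ℝ → ℝ} {C : ℝ} {χ : LInf} {M : ℝ}

/-- The constant in the weighted bounds of the potentials. -/
def potentialConst (C M : ℝ) : ℝ := Real.exp (2 * M) * C * (expMass (1 / 2)).toReal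

/-- Young's inequality for the slower kernel e^{-|x|/2}, shared by P and Q. -/
theorem norm_mulLp_le_of_enorm_le (hψ : IsExpWeight ψ C) (hχ : ∀ᵐ x, χ x = ψ x) {γ : ℝ} {Y : SpaceF}
    {p : LTwo} (h : ∀ᵐ x, ‖ψ x * p x‖ₑ ≤ ENNReal.ofReal (Real.exp (2 * M) * C) *
      expConv (1 / 2) (fun y => ‖ψ y * source γ Y y‖ₑ) x) :
    ‖mulLp ∞ 2 2 χ p‖ ≤ potentialConst C M * ‖mulLp ∞ 2 2 χ (sourceTwo γ Y)‖ := by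
  set f := mulLp ∞ 2 2 χ (sourceTwo γ Y) with hf
  have hC : 0 ≤ Real.exp (2 * M) * C := mul_nonneg (Real.exp_nonneg _) (zero_le_one.trans hψ.one_le)
  have hae : ∀ᵐ y, ψ y * source γ Y y = f y := by
    filter_upwards [hχ, coeFn_sourceTwo γ Y, coeFn_mulLp (r := 2) χ (sourceTwo γ Y)] with y e1 e2 e3
    rw [hf, e3, e1, e2]
  have hconv : ∀ x, expConv (1 / 2) (fun y => ‖ψ y * source γ Y y‖ₑ) x
      = expConv (1 / 2) (fun y => ‖f y‖ₑ) x := fun x => by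
    refine lintegral_congr_ae ?_
    filter_upwards [hae] with y hy
    rw [hy]
  have hmass := expMass_lt_top (a := 1 / 2) (by norm_num)
  have key : eLpNorm (mulLp ∞ 2 2 χ p) 2 volume ≤
      ENNReal.ofReal (Real.exp (2 * M) * C) * (expMass (1 / 2) * eLpNorm f 2 volume) := by
    rw [← ENNReal.pow_le_pow_left_iff two_ne_zero, eLpNorm_two_sq, mul_pow]
    calc ∫⁻ x, ‖mulLp ∞ 2 2 χ p x‖ₑ ^ 2
        ≤ ∫⁻ x, ENNReal.ofReal (Real.exp (2 * M) * C) ^ 2 *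
            expConv (1 / 2) (fun y => ‖f y‖ₑ) x ^ 2 := by
          refine lintegral_mono_ae ?_
          filter_upwards [h, hχ, coeFn_mulLp (r := 2) χ p] with x hx e1 e2
          rw [e2, e1, ← mul_pow, ← hconv]
          gcongr
      _ = ENNReal.ofReal (Real.exp (2 * M) * C) ^ 2 *
            eLpNorm (expConv (1 / 2) fun y => ‖f y‖ₑ) 2 volume ^ 2 := by
          rw [lintegral_const_mul' _ _ (ENNReal.pow_ne_top ENNReal.ofReal_ne_top), eLpNorm_two_sq]
          simp
      _ ≤ _ := by
          gcongr
          exact eLpNorm_two_expConv_le _ (Lp.aestronglyMeasurable f)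
  rw [Lp.norm_def, Lp.norm_def, potentialConst]
  refine (ENNReal.toReal_mono ?_ key).trans_eq ?_
  · exact ENNReal.mul_ne_top ENNReal.ofReal_ne_top
      (ENNReal.mul_ne_top hmass.ne (Lp.eLpNorm_ne_top f))
  · rw [ENNReal.toReal_mul, ENNReal.toReal_mul, ENNReal.toReal_ofReal hC, mul_assoc _ (ENNReal.toReal _)]

theorem norm_mulLp_PTwo_le (hψ : IsExpWeight ψ C) (hχ : ∀ᵐ x, χ x = ψ x) (γ : ℝ) {Y : SpaceF}
    (hY : ‖Y‖ ≤ M) :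
    ‖mulLp ∞ 2 2 χ (PTwo γ Y)‖ ≤ potentialConst C M * ‖mulLp ∞ 2 2 χ (sourceTwo γ Y)‖ := by
  refine norm_mulLp_le_of_enorm_le hψ hχ ?_
  have hz : ∀ᵐ x, |Y.zeta x| ≤ M := (ae_abs_zeta_le Y).mono fun x hx => hx.trans hY
  filter_upwards [hz, coeFn_PTwo γ Y] with x hx e
  rw [e, P]
  refine enorm_mul_integral_le hψ (Real.exp_nonneg _) (by norm_num [abs_of_pos]) ?_
  filter_upwards [hz] with y hy
  rw [abs_mul, Real.abs_exp]
  exact mul_le_mul_of_nonneg_right (exp_sign_le hx hy) (abs_nonneg _)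

theorem norm_mulLp_QTwo_le (hψ : IsExpWeight ψ C) (hχ : ∀ᵐ x, χ x = ψ x) (γ : ℝ) {Y : SpaceF}
    (hY : ‖Y‖ ≤ M) :
    ‖mulLp ∞ 2 2 χ (QTwo γ Y)‖ ≤ potentialConst C M * ‖mulLp ∞ 2 2 χ (sourceTwo γ Y)‖ := by
  refine norm_mulLp_le_of_enorm_le hψ hχ ?_
  have hz : ∀ᵐ x, |Y.zeta x| ≤ M := (ae_abs_zeta_le Y).mono fun x hx => hx.trans hY
  filter_upwards [hz, coeFn_QTwo γ Y] with x hx e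
  rw [e, Q]
  refine enorm_mul_integral_le hψ (Real.exp_nonneg _) (by norm_num [abs_of_pos]) ?_
  filter_upwards [hz] with y hy
  rw [abs_mul, abs_mul, Real.abs_exp]
  refine mul_le_mul_of_nonneg_right ?_ (abs_nonneg _)
  exact (mul_le_of_le_one_left (Real.exp_nonneg _) (abs_sign_le_one _)).trans (exp_sign_le hx hy)

/-- In U²q one factor U carries the weight; the other U and q are merely bounded. This is why the
bound of q must be available first. -/
theorem norm_mulLp_sourceTwo_le (γ : ℝ) {Y : SpaceF} {B N : ℝ} (hB : 0 ≤ B) (hN : 0 ≤ N)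
    (hU : ∀ᵐ x, |Y.U x| ≤ B) (hq : ∀ᵐ x, |Y.q x| ≤ N) :
    ‖mulLp ∞ 2 2 χ (sourceTwo γ Y)‖ ≤
      |(3 - 2 * γ) / 2| * B * N * ‖mulLp ∞ 2 2 χ (UTwo Y)‖ + |γ / 2| * ‖mulLp ∞ 2 2 χ (hL Y)‖ := by
  refine Lp.norm_le_add_of_ae_le ?_ (by positivity) (by positivity)
  filter_upwards [hU, hq, coeFn_sourceTwo γ Y, coeFn_mulLp (r := 2) χ (sourceTwo γ Y),
    coeFn_mulLp (r := 2) χ (UTwo Y), coeFn_mulLp (r := 2) χ (hL Y)] with x hU hq e1 e2 e3 e4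
  rw [e2, e3, e4, e1, source, coeFn_UTwo, coeFn_hL]
  calc |χ x * ((3 - 2 * γ) / 2 * Y.U x ^ 2 * Y.q x + γ / 2 * Y.h x)|
      = |(3 - 2 * γ) / 2 * (χ x * Y.U x) * Y.U x * Y.q x + γ / 2 * (χ x * Y.h x)| := by
        congr 1; ring
    _ ≤ |(3 - 2 * γ) / 2| * |χ x * Y.U x| * |Y.U x| * |Y.q x| + |γ / 2| * |χ x * Y.h x| := by
        refine (abs_add_le _ _).trans_eq ?_
        rw [abs_mul (γ / 2), abs_mul _ (Y.q x), abs_mul _ (Y.U x), abs_mul ((3 - 2 * γ) / 2)]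
    _ ≤ |(3 - 2 * γ) / 2| * |χ x * Y.U x| * B * N + |γ / 2| * |χ x * Y.h x| := by gcongr
    _ = _ := by ring

end WeightedPotential

end SpaceF

end

/-! ### Grönwall estimates: sup bounds of q, w, h, then weighted L² bounds. -/

noncomputable section

namespace SpaceF

theorem norm_prod₃_le {E : Type*} [NormedAddCommGroup E] {x : E × E × E} {c : ℝ} (h₁ : ‖x.1‖ ≤ c)
    (h₂ : ‖x.2.1‖ ≤ c) (h₃ : ‖x.2.2‖ ≤ c) : ‖x‖ ≤ c :=
  norm_prod_le_iff.2 ⟨h₁, norm_prod_le_iff.2 ⟨h₂, h₃⟩⟩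

theorem abs_wRate_le {a B u P' q h γ : ℝ} (hu : |u| ≤ B) (hP : |P'| ≤ B) :
    |γ / 2 * h + (a * u ^ 2 - P') * q| ≤ |γ / 2| * |h| + (|a| * B ^ 2 + B) * |q| := by
  calc |γ / 2 * h + (a * u ^ 2 - P') * q| ≤ |γ / 2 * h| + |(a * u ^ 2 - P') * q| := abs_add_le _ _
    _ = |γ / 2| * |h| + |a * u ^ 2 - P'| * |q| := by rw [abs_mul, abs_mul]
    _ ≤ _ := by
        gcongr
        calc |a * u ^ 2 - P'| ≤ |a * u ^ 2| + |P'| := abs_sub _ _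
          _ = |a| * |u| ^ 2 + |P'| := by rw [abs_mul, abs_pow]
          _ ≤ _ := by gcongr

theorem abs_three_sq_sub_le {B u P' : ℝ} (hu : |u| ≤ B) (hP : |P'| ≤ B) :
    |3 * u ^ 2 - 2 * P'| ≤ 3 * B ^ 2 + 2 * B := by
  calc |3 * u ^ 2 - 2 * P'| ≤ |3 * u ^ 2| + |2 * P'| := abs_sub _ _
    _ = 3 * |u| ^ 2 + 2 * |P'| := by rw [abs_mul, abs_mul, abs_pow]; norm_num
    _ ≤ _ := by gcongr

theorem abs_hRate_le {B u P' Q' q w : ℝ} (hu : |u| ≤ B) (hP : |P'| ≤ B) (hQ : |Q'| ≤ B) :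
    |-2 * Q' * u * q + (3 * u ^ 2 - 2 * P') * w| ≤ 2 * B ^ 2 * |q| + (3 * B ^ 2 + 2 * B) * |w| := by
  have hB : 0 ≤ B := (abs_nonneg _).trans hu
  calc |-2 * Q' * u * q + (3 * u ^ 2 - 2 * P') * w|
      ≤ |-2 * Q' * u * q| + |(3 * u ^ 2 - 2 * P') * w| := abs_add_le _ _
    _ = 2 * (|Q'| * |u|) * |q| + |3 * u ^ 2 - 2 * P'| * |w| := by
        rw [abs_mul _ w, abs_mul _ q, abs_mul _ u, abs_mul (-2), abs_neg, abs_two]; ring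
    _ ≤ 2 * (B * B) * |q| + (3 * B ^ 2 + 2 * B) * |w| := by
        gcongr
        exact abs_three_sq_sub_le hu hP
    _ = _ := by ring

/-! ### Propagation of the bounds of `q`, `w` and `h` -/

/-- At fixed ξ this is Grönwall for a linear system in (q, w, h) with bounded coefficients. The
solution is differentiable in L² rather than pointwise, so the argument is run in L²(A) for every A
of finite measure, with a factor K independent of A. -/
theorem exists_forall_ae_abs_le (γ T M : ℝ) : ∃ K : ℝ, 0 ≤ K ∧ ∀ Y : ℝ → SpaceF, IsSolution γ T Y →
    (∀ t ∈ Icc 0 T, ‖Y t‖ ≤ M) → ∀ N : ℝ, 0 ≤ N → (∀ᵐ x, |(Y 0).q x| ≤ N) →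
    (∀ᵐ x, |(Y 0).w x| ≤ N) → (∀ᵐ x, |(Y 0).h x| ≤ N) → ∀ t ∈ Icc 0 T,
      (∀ᵐ x, |(Y t).q x| ≤ K * N) ∧ (∀ᵐ x, |(Y t).w x| ≤ K * N) ∧ (∀ᵐ x, |(Y t).h x| ≤ K * N) := by
  obtain ⟨B, hB, hcoef⟩ := exists_coefficient_bound γ M
  set a : ℝ := (3 - 2 * γ) / 2 with ha
  -- The product norm is a maximum, so L only has to dominate each row of the coefficient matrix; it
  -- is the sum of all the entries' bounds.
  set L : ℝ := |γ| + |γ / 2| + (|a| * B ^ 2 + B) + 2 * B ^ 2 + (3 * B ^ 2 + 2 * B) with hLdef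
  have hL0 : 0 ≤ L := by positivity
  refine ⟨Real.exp (L * T), Real.exp_nonneg _, fun Y hY hM N hN hq₀ hw₀ hh₀ t ht => ?_⟩
  have hD := hY.hasDerivWithinAt
  have main : ∀ A, MeasurableSet A → volume A < ∞ →
      (eLpNorm (A.indicator (Y t).q) 2 volume ≤ ENNReal.ofReal (Real.exp (L * T) * N) *
        eLpNorm (A.indicator 1 : ℝ → ℝ) 2 volume) ∧
      (eLpNorm (A.indicator (Y t).w) 2 volume ≤ ENNReal.ofReal (Real.exp (L * T) * N) *
        eLpNorm (A.indicator 1 : ℝ → ℝ) 2 volume) ∧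
      (eLpNorm (A.indicator (Y t).h) 2 volume ≤ ENNReal.ofReal (Real.exp (L * T) * N) *
        eLpNorm (A.indicator 1 : ℝ → ℝ) 2 volume) := by
    intro A hA hA'
    have m2 : MemLp (A.indicator 1 : ℝ → ℝ) 2 volume :=
      memLp_indicator_const 2 hA (1 : ℝ) (Or.inr hA'.ne)
    have mt : MemLp (A.indicator 1 : ℝ → ℝ) ∞ volume :=
      memLp_indicator_const ∞ hA (1 : ℝ) (Or.inr hA'.ne)
    set m : LTwo →L[ℝ] LTwo := mulLp ∞ 2 2 mt.toLp with hm
    have em : ∀ g : LTwo, ∀ᵐ x, m g x = A.indicator g x := by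
      intro g
      filter_upwards [coeFn_mulLp (r := 2) mt.toLp g, mt.coeFn_toLp] with x e1 e2
      rw [hm, e1, e2]
      by_cases hx : x ∈ A <;> simp [hx]
    -- Restricted to A, q is the constant vector 1_A ∈ L² plus a linear function of v. The constant
    -- drops out of the time derivative but makes the inequality homogeneous in (q, w, h).
    have eq : ∀ Z : SpaceF, ∀ᵐ x, (m2.toLp + m (vL Z)) x = A.indicator Z.q x := by
      intro Z
      filter_upwards [em (vL Z), m2.coeFn_toLp, Lp.coeFn_add m2.toLp (m (vL Z))] with x e1 e2 e3
      rw [e3, Pi.add_apply, e1, e2, coeFn_vL]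
      by_cases hx : x ∈ A <;> simp [hx, q, add_comm]
    let Λ : SpaceF →L[ℝ] LTwo × LTwo × LTwo := (m.comp vL).prod ((m.comp wL).prod (m.comp hL))
    have hE : ∀ s ∈ Icc 0 T, HasDerivWithinAt
        (fun s => ((m2.toLp, 0, 0) : LTwo × LTwo × LTwo) + Λ (Y s))
        (Λ (vectorField γ (Y s))) (Icc 0 T) s := fun s hs =>
      (Λ.hasFDerivAt.comp_hasDerivWithinAt s (hD s hs)).const_add _
    have hcomp : ∀ Z : SpaceF, ((m2.toLp, 0, 0) : LTwo × LTwo × LTwo) + Λ Z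
        = (m2.toLp + m (vL Z), m (wL Z), m (hL Z)) := fun Z => by
      simp [Λ]
    have hb : ∀ s ∈ Icc 0 T, ‖Λ (vectorField γ (Y s))‖ ≤
        L * ‖((m2.toLp, 0, 0) : LTwo × LTwo × LTwo) + Λ (Y s)‖ := by
      intro s hs
      rw [hcomp]
      set E : LTwo × LTwo × LTwo := (m2.toLp + m (vL (Y s)), m (wL (Y s)), m (hL (Y s))) with hEdef
      have hE1 : ‖E.1‖ ≤ ‖E‖ := norm_fst_le E
      have hE2 : ‖E.2.1‖ ≤ ‖E‖ := (norm_fst_le E.2).trans (norm_snd_le E)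
      have hE3 : ‖E.2.2‖ ≤ ‖E‖ := (norm_snd_le E.2).trans (norm_snd_le E)
      have hn := norm_nonneg E
      have hc := hcoef (Y s) (hM s hs)
      refine norm_prod₃_le ?_ ?_ ?_
      · change ‖m (γ • wL (Y s))‖ ≤ _
        rw [map_smul, norm_smul, Real.norm_eq_abs]
        refine mul_le_mul ?_ hE2 (norm_nonneg _) hL0
        rw [hLdef]
        nlinarith [abs_nonneg (γ / 2), abs_nonneg a, sq_nonneg B, mul_nonneg (abs_nonneg a) (sq_nonneg B)]
      · change ‖m (wRate γ (Y s))‖ ≤ _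
        have h := Lp.norm_le_add_of_ae_le (f := m (wRate γ (Y s))) (g₁ := E.2.2) (g₂ := E.1)
          (c₁ := |γ / 2|) (c₂ := |a| * B ^ 2 + B) (by
            filter_upwards [hc, em (wRate γ (Y s)), em (hL (Y s)), eq (Y s), coeFn_wRate γ (Y s)]
              with x hc e1 e2 e3 e4
            rw [e1, e2, e3]
            by_cases hx : x ∈ A
            · simp only [indicator_of_mem hx, e4, coeFn_hL]
              exact abs_wRate_le hc.1 hc.2.1
            · simp [hx]) (by positivity) (by positivity)
        refine h.trans ?_
        calc |γ / 2| * ‖E.2.2‖ + (|a| * B ^ 2 + B) * ‖E.1‖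
            ≤ |γ / 2| * ‖E‖ + (|a| * B ^ 2 + B) * ‖E‖ := by gcongr
          _ = (|γ / 2| + (|a| * B ^ 2 + B)) * ‖E‖ := by ring
          _ ≤ L * ‖E‖ := by
              gcongr
              rw [hLdef]
              nlinarith [abs_nonneg γ, sq_nonneg B]
      · change ‖m (hRate γ (Y s))‖ ≤ _
        have h := Lp.norm_le_add_of_ae_le (f := m (hRate γ (Y s))) (g₁ := E.1) (g₂ := E.2.1)
          (c₁ := 2 * B ^ 2) (c₂ := 3 * B ^ 2 + 2 * B) (by
            filter_upwards [hc, em (hRate γ (Y s)), em (wL (Y s)), eq (Y s), coeFn_hRate γ (Y s)]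
              with x hc e1 e2 e3 e4
            rw [e1, e2, e3]
            by_cases hx : x ∈ A
            · simp only [indicator_of_mem hx, e4, coeFn_wL]
              exact abs_hRate_le hc.1 hc.2.1 hc.2.2
            · simp [hx]) (by positivity) (by positivity)
        refine h.trans ?_
        calc 2 * B ^ 2 * ‖E.1‖ + (3 * B ^ 2 + 2 * B) * ‖E.2.1‖
            ≤ 2 * B ^ 2 * ‖E‖ + (3 * B ^ 2 + 2 * B) * ‖E‖ := by gcongr
          _ = (2 * B ^ 2 + (3 * B ^ 2 + 2 * B)) * ‖E‖ := by ring
          _ ≤ L * ‖E‖ := by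
              gcongr
              rw [hLdef]
              nlinarith [abs_nonneg γ, abs_nonneg (γ / 2), mul_nonneg (abs_nonneg a) (sq_nonneg B)]
    have hind : ∀ {f : ℝ → ℝ} {g : LTwo}, (∀ᵐ x, |f x| ≤ N) → (∀ᵐ x, g x = A.indicator f x) →
        ‖g‖ ≤ N * ‖(m2.toLp : LTwo)‖ := by
      intro f g hf hg
      have h := Lp.norm_le_add_of_ae_le (f := g) (g₁ := m2.toLp) (g₂ := 0) (c₁ := N) (c₂ := 0) (by
        filter_upwards [hf, hg, m2.coeFn_toLp] with x h1 h2 h3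
        rw [h2, h3]
        by_cases hx : x ∈ A <;> simp [hx, h1]) hN le_rfl
      simpa using h
    have h0 : ‖((m2.toLp, 0, 0) : LTwo × LTwo × LTwo) + Λ (Y 0)‖ ≤ N * ‖(m2.toLp : LTwo)‖ := by
      rw [hcomp]
      exact norm_prod₃_le (hind hq₀ (eq _)) (hind hw₀ (em _)) (hind hh₀ (em _))
    have hfin := norm_le_mul_exp_of_norm_deriv_le hL0 hE hb h0 t ht
    rw [hcomp] at hfin
    have hout : ∀ {f : ℝ → ℝ} {g : LTwo}, ‖g‖ ≤ N * ‖(m2.toLp : LTwo)‖ * Real.exp (L * T) →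
        (∀ᵐ x, g x = A.indicator f x) → eLpNorm (A.indicator f) 2 volume ≤
          ENNReal.ofReal (Real.exp (L * T) * N) * eLpNorm (A.indicator 1 : ℝ → ℝ) 2 volume := by
      intro f g hg hae
      rw [← eLpNorm_congr_ae hae, ← ENNReal.ofReal_toReal (Lp.eLpNorm_ne_top g), ← Lp.norm_def]
      refine (ENNReal.ofReal_le_ofReal hg).trans_eq ?_
      rw [Lp.norm_toLp, ← ENNReal.ofReal_toReal m2.2.ne, ← ENNReal.ofReal_mul (by positivity),
        ENNReal.toReal_ofReal ENNReal.toReal_nonneg]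
      congr 1; ring
    exact ⟨hout ((norm_fst_le _).trans hfin) (eq _),
      hout ((norm_fst_le _).trans ((norm_snd_le _).trans hfin)) (em _),
      hout ((norm_snd_le _).trans ((norm_snd_le _).trans hfin)) (em _)⟩
  have hKN : 0 ≤ Real.exp (L * T) * N := by positivity
  exact ⟨ae_abs_le_of_forall_eLpNorm_indicator_le
      ((Lp.aestronglyMeasurable (vL (Y t))).add aestronglyMeasurable_const) hKN
      fun A hA hA' => (main A hA hA').1,
    ae_abs_le_of_forall_eLpNorm_indicator_le (Lp.aestronglyMeasurable (wL (Y t))) hKN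
      fun A hA hA' => (main A hA hA').2.1,
    ae_abs_le_of_forall_eLpNorm_indicator_le (Lp.aestronglyMeasurable (hL (Y t))) hKN
      fun A hA hA' => (main A hA hA').2.2⟩

/-! ### Propagation of the weighted `L²` bounds -/

/-- The components `U`, `w`, `h`, multiplied by a bounded weight. -/
def weightedPart (χ : LInf) : SpaceF →L[ℝ] LTwo × LTwo × LTwo :=
  ((mulLp ∞ 2 2 χ).comp UTwo).prod (((mulLp ∞ 2 2 χ).comp wL).prod ((mulLp ∞ 2 2 χ).comp hL))

/-- Once q is bounded, the weighted potentials are controlled by the weighted U and h, so (ψU, ψw,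
ψh) obeys a closed linear inequality. The weight enters K only through C, never through its
supremum, which allows passage to unbounded weights. -/
theorem exists_norm_weightedPart_le (γ T M C N : ℝ) (hN : 0 ≤ N) : ∃ K : ℝ, 0 ≤ K ∧
    ∀ Y : ℝ → SpaceF, IsSolution γ T Y → (∀ t ∈ Icc 0 T, ‖Y t‖ ≤ M) →
    (∀ t ∈ Icc 0 T, ∀ᵐ x, |(Y t).q x| ≤ N) → ∀ (ψ : ℝ → ℝ) (χ : LInf), IsExpWeight ψ C →
    (∀ᵐ x, χ x = ψ x) → ∀ t ∈ Icc 0 T, ‖weightedPart χ (Y t)‖ ≤ K * ‖weightedPart χ (Y 0)‖ ∧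
      ‖mulLp ∞ 2 2 χ (PTwo γ (Y t))‖ ≤ K * ‖weightedPart χ (Y t)‖ ∧
      ‖mulLp ∞ 2 2 χ (QTwo γ (Y t))‖ ≤ K * ‖weightedPart χ (Y t)‖ := by
  rcases le_or_gt 1 C with hC1 | hC1
  swap
  · exact ⟨0, le_rfl, fun Y _ _ _ ψ χ hψ => absurd hψ.one_le (not_le.2 hC1)⟩
  obtain ⟨B, hB, hcoef⟩ := exists_coefficient_bound γ M
  set a : ℝ := (3 - 2 * γ) / 2 with ha
  have hpc : 0 ≤ potentialConst C M := by
    have := zero_le_one.trans hC1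
    rw [potentialConst]; positivity
  set D : ℝ := potentialConst C M * (|a| * B * N + |γ / 2|) with hD
  have hD0 : 0 ≤ D := by positivity
  -- The three groups bound the equations for U, w and h respectively; D bounds the weighted
  -- potentials.
  set L : ℝ := D + (|γ / 2| + |a| * B * N + N * D) + (2 * B * N + (3 * B ^ 2 + 2 * B)) with hLdef
  have hL0 : 0 ≤ L := by positivity
  refine ⟨D + Real.exp (L * T), by positivity, fun Y hY hM hq ψ χ hψ hχ t ht => ?_⟩
  have hDer := hY.hasDerivWithinAt
  have hpot : ∀ s ∈ Icc 0 T, ‖mulLp ∞ 2 2 χ (PTwo γ (Y s))‖ ≤ D * ‖weightedPart χ (Y s)‖ ∧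
      ‖mulLp ∞ 2 2 χ (QTwo γ (Y s))‖ ≤ D * ‖weightedPart χ (Y s)‖ := by
    intro s hs
    set E := weightedPart χ (Y s) with hEdef
    have hE1 : ‖E.1‖ ≤ ‖E‖ := norm_fst_le E
    have hE3 : ‖E.2.2‖ ≤ ‖E‖ := (norm_snd_le E.2).trans (norm_snd_le E)
    have hsrc : ‖mulLp ∞ 2 2 χ (sourceTwo γ (Y s))‖ ≤ (|a| * B * N + |γ / 2|) * ‖E‖ := by
      refine (norm_mulLp_sourceTwo_le γ hB hN
        ((hcoef (Y s) (hM s hs)).mono fun x hx => hx.1) (hq s hs)).trans ?_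
      calc |a| * B * N * ‖E.1‖ + |γ / 2| * ‖E.2.2‖ ≤ |a| * B * N * ‖E‖ + |γ / 2| * ‖E‖ := by gcongr
        _ = _ := by ring
    have hD' : D * ‖E‖ = potentialConst C M * ((|a| * B * N + |γ / 2|) * ‖E‖) := by rw [hD]; ring
    rw [hD']
    exact ⟨(norm_mulLp_PTwo_le hψ hχ γ (hM s hs)).trans (by gcongr),
      (norm_mulLp_QTwo_le hψ hχ γ (hM s hs)).trans (by gcongr)⟩
  have hb : ∀ s ∈ Icc 0 T, ‖weightedPart χ (vectorField γ (Y s))‖ ≤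
      L * ‖weightedPart χ (Y s)‖ := by
    intro s hs
    obtain ⟨hP, hQ⟩ := hpot s hs
    have hc := hcoef (Y s) (hM s hs)
    set E := weightedPart χ (Y s) with hEdef
    have hE1 : ‖E.1‖ ≤ ‖E‖ := norm_fst_le E
    have hE2 : ‖E.2.1‖ ≤ ‖E‖ := (norm_fst_le E.2).trans (norm_snd_le E)
    have hE3 : ‖E.2.2‖ ≤ ‖E‖ := (norm_snd_le E.2).trans (norm_snd_le E)
    have e1 : ∀ᵐ x, E.1 x = χ x * (Y s).U x := coeFn_mulLp (r := 2) χ (UTwo (Y s))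
    have e2 : ∀ᵐ x, E.2.1 x = χ x * (Y s).w x := coeFn_mulLp (r := 2) χ (wL (Y s))
    have e3 : ∀ᵐ x, E.2.2 x = χ x * (Y s).h x := coeFn_mulLp (r := 2) χ (hL (Y s))
    refine norm_prod₃_le ?_ ?_ ?_
    · change ‖mulLp ∞ 2 2 χ (-QTwo γ (Y s))‖ ≤ _
      rw [map_neg, norm_neg]
      refine hQ.trans ?_
      gcongr
      have h1 : 0 ≤ |γ / 2| + |a| * B * N + N * D := by positivity
      have h2 : 0 ≤ 2 * B * N + (3 * B ^ 2 + 2 * B) := by positivity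
      rw [hLdef]
      linarith
    · change ‖mulLp ∞ 2 2 χ (wRate γ (Y s))‖ ≤ _
      have h := Lp.norm_le_add_add_of_ae_le (f := mulLp ∞ 2 2 χ (wRate γ (Y s))) (g₁ := E.2.2)
        (g₂ := E.1) (g₃ := mulLp ∞ 2 2 χ (PTwo γ (Y s))) (c₁ := |γ / 2|) (c₂ := |a| * B * N)
        (c₃ := N) (by
          filter_upwards [hc, hq s hs, e1, e3, coeFn_mulLp (r := 2) χ (wRate γ (Y s)),
            coeFn_wRate γ (Y s), coeFn_mulLp (r := 2) χ (PTwo γ (Y s)), coeFn_PTwo γ (Y s)]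
            with x hc hq e1 e3 f1 f2 f3 f4
          rw [e1, e3, f1, f2, f3, f4]
          calc |χ x * (γ / 2 * (Y s).h x + (a * (Y s).U x ^ 2 - P γ (Y s) x) * (Y s).q x)|
              = |γ / 2 * (χ x * (Y s).h x) + a * (χ x * (Y s).U x) * (Y s).U x * (Y s).q x
                - (χ x * P γ (Y s) x) * (Y s).q x| := by congr 1; ring
            _ ≤ |γ / 2 * (χ x * (Y s).h x)| + |a * (χ x * (Y s).U x) * (Y s).U x * (Y s).q x|
                + |(χ x * P γ (Y s) x) * (Y s).q x| :=
                (abs_sub _ _).trans (by gcongr; exact abs_add_le _ _)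
            _ = |γ / 2| * |χ x * (Y s).h x| + |a| * |χ x * (Y s).U x| * |(Y s).U x| * |(Y s).q x|
                + |χ x * P γ (Y s) x| * |(Y s).q x| := by
                rw [abs_mul (γ / 2), abs_mul _ ((Y s).q x), abs_mul _ ((Y s).U x), abs_mul a,
                  abs_mul _ ((Y s).q x)]
            _ ≤ |γ / 2| * |χ x * (Y s).h x| + |a| * |χ x * (Y s).U x| * B * N
                + |χ x * P γ (Y s) x| * N := by
                gcongr
                exact hc.1
            _ = _ := by ring) (by positivity) (by positivity) hN
      refine h.trans ?_
      calc |γ / 2| * ‖E.2.2‖ + |a| * B * N * ‖E.1‖ + N * ‖mulLp ∞ 2 2 χ (PTwo γ (Y s))‖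
          ≤ |γ / 2| * ‖E‖ + |a| * B * N * ‖E‖ + N * (D * ‖E‖) := by gcongr
        _ = (|γ / 2| + |a| * B * N + N * D) * ‖E‖ := by ring
        _ ≤ L * ‖E‖ := by
            gcongr
            have h2 : 0 ≤ 2 * B * N + (3 * B ^ 2 + 2 * B) := by positivity
            rw [hLdef]
            linarith
    · change ‖mulLp ∞ 2 2 χ (hRate γ (Y s))‖ ≤ _
      have h := Lp.norm_le_add_of_ae_le (f := mulLp ∞ 2 2 χ (hRate γ (Y s))) (g₁ := E.1)
        (g₂ := E.2.1) (c₁ := 2 * B * N) (c₂ := 3 * B ^ 2 + 2 * B) (by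
          filter_upwards [hc, hq s hs, e1, e2, coeFn_mulLp (r := 2) χ (hRate γ (Y s)),
            coeFn_hRate γ (Y s)] with x hc hq e1 e2 f1 f2
          rw [e1, e2, f1, f2]
          calc |χ x * (-2 * Q γ (Y s) x * (Y s).U x * (Y s).q x
                + (3 * (Y s).U x ^ 2 - 2 * P γ (Y s) x) * (Y s).w x)|
              = |-2 * Q γ (Y s) x * (χ x * (Y s).U x) * (Y s).q x
                + (3 * (Y s).U x ^ 2 - 2 * P γ (Y s) x) * (χ x * (Y s).w x)| := by congr 1; ring
            _ ≤ |-2 * Q γ (Y s) x * (χ x * (Y s).U x) * (Y s).q x|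
                + |(3 * (Y s).U x ^ 2 - 2 * P γ (Y s) x) * (χ x * (Y s).w x)| := abs_add_le _ _
            _ = 2 * |Q γ (Y s) x| * |χ x * (Y s).U x| * |(Y s).q x|
                + |3 * (Y s).U x ^ 2 - 2 * P γ (Y s) x| * |χ x * (Y s).w x| := by
                rw [abs_mul _ ((Y s).q x), abs_mul _ (χ x * (Y s).U x), abs_mul (-2),
                  abs_mul _ (χ x * (Y s).w x), abs_neg, abs_two]
            _ ≤ 2 * B * |χ x * (Y s).U x| * N + (3 * B ^ 2 + 2 * B) * |χ x * (Y s).w x| := by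
                gcongr
                · exact hc.2.2
                · exact abs_three_sq_sub_le hc.1 hc.2.1
            _ = _ := by ring) (by positivity) (by positivity)
      refine h.trans ?_
      calc 2 * B * N * ‖E.1‖ + (3 * B ^ 2 + 2 * B) * ‖E.2.1‖
          ≤ 2 * B * N * ‖E‖ + (3 * B ^ 2 + 2 * B) * ‖E‖ := by gcongr
        _ = (2 * B * N + (3 * B ^ 2 + 2 * B)) * ‖E‖ := by ring
        _ ≤ L * ‖E‖ := by
            gcongr
            rw [hLdef]
            exact le_add_of_nonneg_left (by positivity)
  have hfin := norm_le_mul_exp_of_norm_deriv_le (x := fun s => weightedPart χ (Y s)) hL0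
    (fun s hs => (weightedPart χ).hasFDerivAt.comp_hasDerivWithinAt s (hDer s hs)) hb le_rfl t ht
  have hexp := Real.exp_nonneg (L * T)
  refine ⟨hfin.trans ?_, (hpot t ht).1.trans ?_, (hpot t ht).2.trans ?_⟩
  · rw [mul_comm]
    gcongr
    exact le_add_of_nonneg_left hD0
  · gcongr
    exact le_add_of_nonneg_right hexp
  · gcongr
    exact le_add_of_nonneg_right hexp

end SpaceF

end

/-! ### Weighted L¹ bound of h, removal of the truncation, and the spaces `F^e` and `F^α`. -/

noncomputable section

namespace SpaceF

/-- Bounds of `q`, `w`, `h` in `L^∞`, of `ψ U` and `ψ w` in `L²` and of `ψ² h` in `L¹`. -/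
structure WeightedBound (ψ : ℝ → ℝ) (N : ℝ) (Y : SpaceF) : Prop where
  nonneg : 0 ≤ N
  q_le : ∀ᵐ x, |Y.q x| ≤ N
  w_le : ∀ᵐ x, |Y.w x| ≤ N
  h_le : ∀ᵐ x, |Y.h x| ≤ N
  U_decay : eLpNorm (fun x => ψ x * Y.U x) 2 volume ≤ ENNReal.ofReal N
  w_decay : eLpNorm (fun x => ψ x * Y.w x) 2 volume ≤ ENNReal.ofReal N
  h_decay : eLpNorm (fun x => ψ x ^ 2 * Y.h x) 1 volume ≤ ENNReal.ofReal N

/-- Interpolation between L^∞ and L¹: |ψh|² = |h| · |ψ²h|. It supplies the initial bound for the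
third component of the weighted L² estimate. -/
theorem WeightedBound.eLpNorm_mul_h_le {ψ : ℝ → ℝ} {N : ℝ} {Y : SpaceF} (hY : WeightedBound ψ N Y) :
    eLpNorm (fun x => ψ x * Y.h x) 2 volume ≤ ENNReal.ofReal N := by
  rw [← ENNReal.pow_le_pow_left_iff two_ne_zero, eLpNorm_two_sq]
  calc ∫⁻ x, ‖ψ x * Y.h x‖ₑ ^ 2 ≤ ∫⁻ x, ENNReal.ofReal N * ‖ψ x ^ 2 * Y.h x‖ₑ := by
        refine lintegral_mono_ae ?_
        filter_upwards [hY.h_le] with x hx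
        have : ‖Y.h x‖ₑ ≤ ENNReal.ofReal N := by
          rw [← ofReal_norm, Real.norm_eq_abs]
          exact ENNReal.ofReal_le_ofReal hx
        calc ‖ψ x * Y.h x‖ₑ ^ 2 = ‖Y.h x‖ₑ * ‖ψ x ^ 2 * Y.h x‖ₑ := by
              rw [enorm_mul, enorm_mul, enorm_pow]; ring
          _ ≤ _ := by gcongr
    _ = ENNReal.ofReal N * eLpNorm (fun x => ψ x ^ 2 * Y.h x) 1 volume := by
        rw [lintegral_const_mul' _ _ ENNReal.ofReal_ne_top, eLpNorm_one_eq_lintegral_enorm]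
    _ ≤ ENNReal.ofReal N ^ 2 := by
        rw [sq]
        gcongr
        exact hY.h_decay

theorem Lp.norm_le_of_eLpNorm_le {p : ℝ≥0∞} {f : Lp ℝ p (volume : Measure ℝ)} {g : ℝ → ℝ} {N : ℝ}
    (hN : 0 ≤ N) (hfg : ∀ᵐ x, |f x| ≤ |g x|) (hg : eLpNorm g p volume ≤ ENNReal.ofReal N) :
    ‖f‖ ≤ N := by
  rw [Lp.norm_def]
  exact ENNReal.toReal_le_of_le_ofReal hN ((eLpNorm_mono_ae hfg).trans hg)

theorem Lp.eLpNorm_le_of_norm_le {p : ℝ≥0∞} {f : Lp ℝ p (volume : Measure ℝ)} {g : ℝ → ℝ} {N : ℝ}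
    (hfg : ∀ᵐ x, f x = g x) (hf : ‖f‖ ≤ N) : eLpNorm g p volume ≤ ENNReal.ofReal N := by
  rw [← eLpNorm_congr_ae hfg, ← ENNReal.ofReal_toReal (Lp.eLpNorm_ne_top f), ← Lp.norm_def]
  exact ENNReal.ofReal_le_ofReal hf

/-- Each term contains two decaying factors, (Q, U), (U, w) or (P, w), and each of them receives one
copy of the weight `c`; the left-over q and U are bounded. Cauchy–Schwarz then applies. -/
theorem abs_mul_mul_hRate_le {c B N u P' Q' q w : ℝ} (hu : |u| ≤ B) (hq : |q| ≤ N) :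
    |c * c * (-2 * Q' * u * q + (3 * u ^ 2 - 2 * P') * w)| ≤ 2 * N * |c * Q' * (c * u)|
      + 3 * B * |c * u * (c * w)| + 2 * |c * P' * (c * w)| := by
  calc |c * c * (-2 * Q' * u * q + (3 * u ^ 2 - 2 * P') * w)|
      = |-2 * q * (c * Q' * (c * u)) + 3 * u * (c * u * (c * w)) - 2 * (c * P' * (c * w))| := by
        congr 1; ring
    _ ≤ |-2 * q * (c * Q' * (c * u))| + |3 * u * (c * u * (c * w))| + |2 * (c * P' * (c * w))| :=
        (abs_sub _ _).trans (by gcongr; exact abs_add_le _ _)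
    _ = 2 * |q| * |c * Q' * (c * u)| + 3 * |u| * |c * u * (c * w)| + 2 * |c * P' * (c * w)| := by
        rw [abs_mul _ (c * Q' * (c * u)), abs_mul _ q, abs_mul _ (c * u * (c * w)), abs_mul _ u,
          abs_mul 2, abs_neg, abs_two, abs_of_pos (three_pos : (0 : ℝ) < 3)]
    _ ≤ _ := by gcongr

theorem norm_mulLp_le_of_ae_le {g f a b c d : LTwo} {c₁ c₂ c₃ : ℝ} (h₁ : 0 ≤ c₁) (h₂ : 0 ≤ c₂)
    (h₃ : 0 ≤ c₃)
    (h : ∀ᵐ x, |g x * f x| ≤ c₁ * |a x * b x| + c₂ * |b x * c x| + c₃ * |d x * c x|) :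
    ‖mulLp 2 2 1 g f‖ ≤ c₁ * (‖a‖ * ‖b‖) + c₂ * (‖b‖ * ‖c‖) + c₃ * (‖d‖ * ‖c‖) := by
  have h' : ∀ᵐ x, |mulLp 2 2 1 g f x| ≤ c₁ * |mulLp 2 2 1 a b x| + c₂ * |mulLp 2 2 1 b c x|
      + c₃ * |mulLp 2 2 1 d c x| := by
    filter_upwards [h, coeFn_mulLp (r := 1) g f, coeFn_mulLp (r := 1) a b,
      coeFn_mulLp (r := 1) b c, coeFn_mulLp (r := 1) d c] with x hx e1 e2 e3 e4
    rwa [e1, e2, e3, e4]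
  refine (Lp.norm_le_add_add_of_ae_le h' h₁ h₂ h₃).trans ?_
  gcongr <;> exact norm_mulLp_le _ _

/-- The weighted `L¹` bound of `h` at a fixed level of truncation. -/
theorem norm_mulLp_hL_le {γ T B N N₀ K R : ℝ} {Y : ℝ → SpaceF} (hY : IsSolution γ T Y) (hB : 0 ≤ B)
    (hN : 0 ≤ N) (hK : 0 ≤ K) (hR : 0 ≤ R) (hU : ∀ t ∈ Icc 0 T, ∀ᵐ x, |(Y t).U x| ≤ B)
    (hq : ∀ t ∈ Icc 0 T, ∀ᵐ x, |(Y t).q x| ≤ N) {χ : LInf} {g : LTwo}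
    (hg : ∀ᵐ x, |g x| ≤ |χ x * χ x|)
    (hχ : ∀ t ∈ Icc 0 T, ‖weightedPart χ (Y t)‖ ≤ R ∧ ‖mulLp ∞ 2 2 χ (PTwo γ (Y t))‖ ≤ K * R ∧
      ‖mulLp ∞ 2 2 χ (QTwo γ (Y t))‖ ≤ K * R)
    (h0 : ‖mulLp 2 2 1 g (hL (Y 0))‖ ≤ N₀) : ∀ t ∈ Icc 0 T, ‖mulLp 2 2 1 g (hL (Y t))‖ ≤
      N₀ + (2 * N * (K * R * R) + 3 * B * (R * R) + 2 * (K * R * R)) * T := by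
  have hD := hY.hasDerivWithinAt
  -- With `g` in L², h ↦ g h is bounded from L² to L¹, so the curve is differentiable in L¹. Its
  -- derivative is already bounded by the weighted L² estimates; no second Grönwall argument is
  -- needed.
  refine norm_le_add_mul_of_norm_deriv_le (x := fun t => mulLp 2 2 1 g (hL (Y t)))
    (x' := fun t => mulLp 2 2 1 g (hRate γ (Y t))) (by positivity) (fun t ht => ?_) (fun t ht => ?_) h0
  · exact (((mulLp 2 2 1 g).comp hL).hasFDerivAt.comp_hasDerivWithinAt t (hD t ht))
  · obtain ⟨hE, hP, hQ⟩ := hχ t ht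
    have hmU : ‖mulLp ∞ 2 2 χ (UTwo (Y t))‖ ≤ R := (norm_fst_le (weightedPart χ (Y t))).trans hE
    have hmw : ‖mulLp ∞ 2 2 χ (wL (Y t))‖ ≤ R :=
      (norm_fst_le (weightedPart χ (Y t)).2).trans ((norm_snd_le _).trans hE)
    refine (norm_mulLp_le_of_ae_le (a := mulLp ∞ 2 2 χ (QTwo γ (Y t)))
      (b := mulLp ∞ 2 2 χ (UTwo (Y t))) (c := mulLp ∞ 2 2 χ (wL (Y t)))
      (d := mulLp ∞ 2 2 χ (PTwo γ (Y t))) (c₁ := 2 * N) (c₂ := 3 * B) (c₃ := 2) (by positivity)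
      (by positivity) (by positivity) ?_).trans (by gcongr)
    filter_upwards [hg, hU t ht, hq t ht, coeFn_hRate γ (Y t),
      coeFn_mulLp (r := 2) χ (QTwo γ (Y t)), coeFn_mulLp (r := 2) χ (PTwo γ (Y t)),
      coeFn_mulLp (r := 2) χ (UTwo (Y t)), coeFn_mulLp (r := 2) χ (wL (Y t)),
      coeFn_QTwo γ (Y t), coeFn_PTwo γ (Y t)] with x hg hU hq e2 e6 e7 e8 e9 f1 f2
    rw [e2, e6, e7, e8, e9, f1, f2, coeFn_UTwo, coeFn_wL]
    refine le_trans ?_ (abs_mul_mul_hRate_le hU hq)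
    rw [abs_mul, abs_mul (χ x * χ x)]
    gcongr

/-- The weighted bounds propagate along solutions that are bounded in `F`. -/
theorem exists_weightedBound (γ T M C N : ℝ) : ∃ K : ℝ, ∀ Y : ℝ → SpaceF, IsSolution γ T Y →
    (∀ t ∈ Icc 0 T, ‖Y t‖ ≤ M) → ∀ ψ : ℝ → ℝ, IsExpWeight ψ C → WeightedBound ψ N (Y 0) →
    ∀ t ∈ Icc 0 T, WeightedBound ψ K (Y t) := by
  rcases lt_or_ge N 0 with hN | hN
  · exact ⟨0, fun Y _ _ ψ _ h => absurd h.nonneg (not_le.2 hN)⟩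
  obtain ⟨B, hB, hcoef⟩ := exists_coefficient_bound γ M
  obtain ⟨K₁, hK₁, h₁⟩ := exists_forall_ae_abs_le γ T M
  have hKN : 0 ≤ K₁ * N := by positivity
  obtain ⟨K₂, hK₂, h₂⟩ := exists_norm_weightedPart_le γ T M C (K₁ * N) hKN
  set R : ℝ := K₂ * N with hRdef
  have hR : 0 ≤ R := by positivity
  set S : ℝ := 2 * (K₁ * N) * (K₂ * R * R) + 3 * B * (R * R) + 2 * (K₂ * R * R) with hS
  have hS0 : 0 ≤ S := by positivity
  -- The summands are the sup bound, the weighted L² bound and the weighted L¹ bound. The absolute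
  -- value keeps the constant monotone in its parts before T ≥ 0 is known.
  refine ⟨K₁ * N + R + (N + S * |T|), fun Y hY hM ψ hψ hY₀ t ht => ?_⟩
  have hT : T ≤ |T| := le_abs_self T
  have h0T : (0 : ℝ) ∈ Icc 0 T := ⟨le_rfl, ht.1.trans ht.2⟩
  have hsup := h₁ Y hY hM N hN hY₀.q_le hY₀.w_le hY₀.h_le
  let χ : ℕ → LInf := fun n => (hψ.memLp_truncate n).toLp
  have hχ : ∀ n, ∀ᵐ x, χ n x = min (ψ x) n := fun n => (hψ.memLp_truncate n).coeFn_toLp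
  have habs : ∀ n : ℕ, ∀ x, |min (ψ x) n| ≤ |ψ x| := fun n x => by
    rw [abs_of_nonneg ((hψ.truncate n).nonneg x), abs_of_nonneg (hψ.nonneg x)]
    exact min_le_left _ _
  have hprod : ∀ (n : ℕ) (f : LTwo), ∀ᵐ x, mulLp ∞ 2 2 (χ n) f x = min (ψ x) n * f x := by
    intro n f
    filter_upwards [coeFn_mulLp (r := 2) (χ n) f, hχ n] with x e1 e2
    rw [e1, e2]
  have hstart : ∀ n, ‖weightedPart (χ n) (Y 0)‖ ≤ N := by
    intro n
    have key : ∀ f : LTwo, eLpNorm (fun x => ψ x * f x) 2 volume ≤ ENNReal.ofReal N →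
        ‖mulLp ∞ 2 2 (χ n) f‖ ≤ N := fun f hf =>
      Lp.norm_le_of_eLpNorm_le hN (by
        filter_upwards [hprod n f] with x e
        rw [e, abs_mul, abs_mul]
        exact mul_le_mul_of_nonneg_right (habs n x) (abs_nonneg _)) hf
    exact norm_prod₃_le (key _ hY₀.U_decay) (key _ hY₀.w_decay) (key _ hY₀.eLpNorm_mul_h_le)
  have hall : ∀ n, ∀ s ∈ Icc 0 T, ‖weightedPart (χ n) (Y s)‖ ≤ R ∧
      ‖mulLp ∞ 2 2 (χ n) (PTwo γ (Y s))‖ ≤ K₂ * R ∧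
      ‖mulLp ∞ 2 2 (χ n) (QTwo γ (Y s))‖ ≤ K₂ * R := by
    intro n s hs
    obtain ⟨hE, hP, hQ⟩ := h₂ Y hY hM (fun s hs => (hsup s hs).1) _ (χ n) (hψ.truncate n) (hχ n) s hs
    have hE' : ‖weightedPart (χ n) (Y s)‖ ≤ R := hE.trans (mul_le_mul_of_nonneg_left (hstart n) hK₂)
    exact ⟨hE', hP.trans (by gcongr), hQ.trans (by gcongr)⟩
  -- Since R does not depend on n, Fatou's lemma replaces the truncated weight by ψ.
  have hlim : ∀ f : LTwo, (∀ n, ‖mulLp ∞ 2 2 (χ n) f‖ ≤ R) →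
      eLpNorm (fun x => ψ x * f x) 2 volume ≤ ENNReal.ofReal R := by
    intro f hf
    refine eLpNorm_le_of_forall_of_tendsto (F := fun n x => min (ψ x) n * f x)
      (fun n => (hψ.truncate n).measurable.aestronglyMeasurable.mul (Lp.aestronglyMeasurable f))
      (Filter.Eventually.of_forall fun x => (tendsto_min_natCast (ψ x)).mul_const _) fun n => ?_
    exact Lp.eLpNorm_le_of_norm_le (hprod n f) (hf n)
  have hL1 : eLpNorm (fun x => ψ x ^ 2 * (Y t).h x) 1 volume ≤ ENNReal.ofReal (N + S * T) := by
    have m2 : ∀ n : ℕ, MemLp ((Icc (-(n : ℝ)) n).indicator 1 : ℝ → ℝ) 2 volume := fun n =>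
      memLp_indicator_const 2 measurableSet_Icc (1 : ℝ) (Or.inr measure_Icc_lt_top.ne)
    -- The squared weight is cut off in height and also in space: the restriction to [-n, n] puts it
    -- in L², so that its product with h ∈ L² is in L¹.
    let g : ℕ → LTwo := fun n => mulLp ∞ 2 2 (mulLp ∞ ∞ ∞ (χ n) (χ n)) (m2 n).toLp
    have hg : ∀ n, ∀ᵐ x, g n x = min (ψ x) n ^ 2 * (Icc (-(n : ℝ)) n).indicator 1 x := by
      intro n
      filter_upwards [coeFn_mulLp (r := 2) (mulLp ∞ ∞ ∞ (χ n) (χ n)) (m2 n).toLp,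
        coeFn_mulLp (r := ∞) (χ n) (χ n), (m2 n).coeFn_toLp, hχ n] with x e1 e2 e3 e4
      rw [e1, e2, e3, e4, sq]
    have hind : ∀ (n : ℕ) (x : ℝ), |(Icc (-(n : ℝ)) n).indicator (1 : ℝ → ℝ) x| ≤ 1 := fun n x => by
      by_cases hx : x ∈ Icc (-(n : ℝ)) n <;> simp [hx]
    have hgh : ∀ n, ∀ s, ∀ᵐ x, mulLp 2 2 1 (g n) (hL (Y s)) x =
        min (ψ x) n ^ 2 * (Icc (-(n : ℝ)) n).indicator 1 x * (Y s).h x := by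
      intro n s
      filter_upwards [coeFn_mulLp (r := 1) (g n) (hL (Y s)), hg n] with x e1 e2
      rw [e1, e2, coeFn_hL]
    refine eLpNorm_le_of_forall_of_tendsto
      (F := fun n x => min (ψ x) n ^ 2 * (Icc (-(n : ℝ)) n).indicator 1 x * (Y t).h x)
      (fun n => ?_) (Filter.Eventually.of_forall fun x => ?_) fun n => ?_
    · exact (((hψ.truncate n).measurable.pow_const 2).mul
        (measurable_one.indicator measurableSet_Icc)).aestronglyMeasurable.mul
        (Lp.aestronglyMeasurable (hL (Y t)))
    · have h1 : Filter.Tendsto (fun n : ℕ => (Icc (-(n : ℝ)) n).indicator (1 : ℝ → ℝ) x)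
          Filter.atTop (nhds 1) := by
        refine tendsto_const_nhds.congr' ?_
        filter_upwards [Filter.eventually_ge_atTop ⌈|x|⌉₊] with n hn
        have hx : |x| ≤ n := (Nat.le_ceil _).trans (by exact_mod_cast hn)
        rw [indicator_of_mem (show x ∈ Icc (-(n : ℝ)) n from abs_le.1 hx), Pi.one_apply]
      have h2 := (((tendsto_min_natCast (ψ x)).pow 2).mul h1).mul_const ((Y t).h x)
      rwa [mul_one] at h2
    · refine Lp.eLpNorm_le_of_norm_le (hgh n t) ?_
      refine norm_mulLp_hL_le hY hB hKN hK₂ hR (fun s hs => (hcoef (Y s) (hM s hs)).mono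
        fun x hx => hx.1) (fun s hs => (hsup s hs).1) (χ := χ n) ?_ (hall n) ?_ t ht
      · filter_upwards [hg n, hχ n] with x e1 e2
        rw [e1, e2, sq, abs_mul]
        exact mul_le_of_le_one_right (abs_nonneg _) (hind n x)
      · refine Lp.norm_le_of_eLpNorm_le hN ?_ hY₀.h_decay
        filter_upwards [hgh n 0] with x e
        rw [e, abs_mul, abs_mul, abs_mul, abs_pow, abs_pow]
        gcongr
        exact (mul_le_of_le_one_right (by positivity) (hind n x)).trans
          (pow_le_pow_left₀ (abs_nonneg _) (habs n x) 2)
  have hST : 0 ≤ S * |T| := by positivity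
  have hle1 : K₁ * N ≤ K₁ * N + R + (N + S * |T|) := by linarith
  have hle2 : ENNReal.ofReal R ≤ ENNReal.ofReal (K₁ * N + R + (N + S * |T|)) :=
    ENNReal.ofReal_le_ofReal (by linarith)
  have hle3 : ENNReal.ofReal (N + S * T) ≤ ENNReal.ofReal (K₁ * N + R + (N + S * |T|)) := by
    refine ENNReal.ofReal_le_ofReal ?_
    have : S * T ≤ S * |T| := by gcongr
    linarith
  obtain ⟨hq, hw, hh⟩ := hsup t ht
  exact
    { nonneg := by linarith
      q_le := hq.mono fun x hx => hx.trans hle1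
      w_le := hw.mono fun x hx => hx.trans hle1
      h_le := hh.mono fun x hx => hx.trans hle1
      U_decay := (hlim (UTwo (Y t)) fun n =>
        (norm_fst_le (weightedPart (χ n) (Y t))).trans (hall n t ht).1).trans hle2
      w_decay := (hlim (wL (Y t)) fun n => (norm_fst_le (weightedPart (χ n) (Y t)).2).trans
        ((norm_snd_le _).trans (hall n t ht).1)).trans hle2
      h_decay := hL1.trans hle3 }

/-! ### The spaces `F^e` and `F^α` -/

theorem normF_nonneg (Y : SpaceF) : 0 ≤ Y.normF := (norm_nonneg Y).trans (norm_le_normF Y)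

theorem weightedBound_of_memLp {ψ : ℝ → ℝ} {N : ℝ} {Y : SpaceF} (hq : MemLp Y.q ∞)
    (hw : MemLp Y.w ∞) (hh : MemLp Y.h ∞) (hU : MemLp (fun x => ψ x * Y.U x) 2)
    (hw' : MemLp (fun x => ψ x * Y.w x) 2) (hh' : MemLp (fun x => ψ x ^ 2 * Y.h x) 1)
    (hN : Y.normF + lpNorm Y.q ∞ volume + lpNorm Y.w ∞ volume + lpNorm Y.h ∞ volume
      + lpNorm (fun x => ψ x * Y.U x) 2 volume + lpNorm (fun x => ψ x * Y.w x) 2 volume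
      + lpNorm (fun x => ψ x ^ 2 * Y.h x) 1 volume ≤ N) : WeightedBound ψ N Y := by
  have h0 := normF_nonneg Y
  have h1 : 0 ≤ lpNorm Y.q ∞ volume := lpNorm_nonneg
  have h2 : 0 ≤ lpNorm Y.w ∞ volume := lpNorm_nonneg
  have h3 : 0 ≤ lpNorm Y.h ∞ volume := lpNorm_nonneg
  have h4 : 0 ≤ lpNorm (fun x => ψ x * Y.U x) 2 volume := lpNorm_nonneg
  have h5 : 0 ≤ lpNorm (fun x => ψ x * Y.w x) 2 volume := lpNorm_nonneg
  have h6 : 0 ≤ lpNorm (fun x => ψ x ^ 2 * Y.h x) 1 volume := lpNorm_nonneg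
  exact
    { nonneg := by linarith
      q_le := (ae_le_lpNorm_exponent_top hq).mono fun x hx => hx.trans (by linarith)
      w_le := (ae_le_lpNorm_exponent_top hw).mono fun x hx => hx.trans (by linarith)
      h_le := (ae_le_lpNorm_exponent_top hh).mono fun x hx => hx.trans (by linarith)
      U_decay := by rw [← ofReal_lpNorm hU]; exact ENNReal.ofReal_le_ofReal (by linarith)
      w_decay := by rw [← ofReal_lpNorm hw']; exact ENNReal.ofReal_le_ofReal (by linarith)
      h_decay := by rw [← ofReal_lpNorm hh']; exact ENNReal.ofReal_le_ofReal (by linarith) }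

theorem WeightedBound.memLp {ψ : ℝ → ℝ} (hψ : Measurable ψ) {N : ℝ} {Y : SpaceF}
    (h : WeightedBound ψ N Y) : MemLp Y.q ∞ ∧ MemLp Y.w ∞ ∧ MemLp Y.h ∞ ∧
      MemLp (fun x => ψ x * Y.U x) 2 ∧ MemLp (fun x => ψ x * Y.w x) 2 ∧
      MemLp (fun x => ψ x ^ 2 * Y.h x) 1 :=
  ⟨memLp_top_of_bound ((Lp.aestronglyMeasurable (vL Y)).add aestronglyMeasurable_const) N h.q_le,
    memLp_top_of_bound (Lp.aestronglyMeasurable (wL Y)) N h.w_le,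
    memLp_top_of_bound (Lp.aestronglyMeasurable (hL Y)) N h.h_le,
    ⟨hψ.aestronglyMeasurable.mul (Lp.aestronglyMeasurable (UTwo Y)),
      h.U_decay.trans_lt ENNReal.ofReal_lt_top⟩,
    ⟨hψ.aestronglyMeasurable.mul (Lp.aestronglyMeasurable (wL Y)),
      h.w_decay.trans_lt ENNReal.ofReal_lt_top⟩,
    ⟨(hψ.pow_const 2).aestronglyMeasurable.mul (Lp.aestronglyMeasurable (hL Y)),
      h.h_decay.trans_lt ENNReal.ofReal_lt_top⟩⟩

theorem WeightedBound.norm_le {ψ : ℝ → ℝ} {N : ℝ} {Y : SpaceF} (h : WeightedBound ψ N Y) :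
    Y.normF + lpNorm Y.q ∞ volume + lpNorm Y.w ∞ volume + lpNorm Y.h ∞ volume
      + lpNorm (fun x => ψ x * Y.U x) 2 volume + lpNorm (fun x => ψ x * Y.w x) 2 volume
      + lpNorm (fun x => ψ x ^ 2 * Y.h x) 1 volume ≤ Y.normF + 6 * N := by
  have h1 := lpNorm_le_of_eLpNorm_le h.nonneg (eLpNorm_top_le_of_ae_abs_le h.q_le)
  have h2 := lpNorm_le_of_eLpNorm_le h.nonneg (eLpNorm_top_le_of_ae_abs_le h.w_le)
  have h3 := lpNorm_le_of_eLpNorm_le h.nonneg (eLpNorm_top_le_of_ae_abs_le h.h_le)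
  have h4 := lpNorm_le_of_eLpNorm_le h.nonneg h.U_decay
  have h5 := lpNorm_le_of_eLpNorm_le h.nonneg h.w_decay
  have h6 := lpNorm_le_of_eLpNorm_le h.nonneg h.h_decay
  linarith

/-- The triangle inequality |x| ≤ |y| + |x - y|, halved; the weight uses exactly the half of the
kernel that is available. -/
theorem isExpWeight_exp : IsExpWeight (fun x => Real.exp (|x| / 2)) 1 where
  measurable := by fun_prop
  nonneg x := Real.exp_nonneg _
  one_le := le_rfl
  mul_exp_le x y := by
    rw [one_mul, ← Real.exp_add, ← Real.exp_add, Real.exp_le_exp]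
    have := abs_sub_abs_le_abs_sub x y
    linarith

/-- With d = |x - y|, one has 1 + |x| ≤ (1 + |y|)(1 + d) and 1 + d ≤ α e^{d/α}. Raising to the power
α/2 turns the last factor into α^{α/2} e^{d/2}, which explains the constant. -/
theorem isExpWeight_rpow {α : ℝ} (hα : 1 < α) :
    IsExpWeight (fun x => (1 + |x|) ^ (α / 2)) (α ^ (α / 2)) where
  measurable := by fun_prop
  nonneg x := by positivity
  one_le := Real.one_le_rpow hα.le (by linarith)
  mul_exp_le x y := by
    have hα0 : 0 < α := by linarith
    set d := |x - y| with hd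
    have hd0 : 0 ≤ d := abs_nonneg _
    have h1 : 1 + |x| ≤ (1 + |y|) * (1 + d) := by
      have := abs_sub_abs_le_abs_sub x y
      nlinarith [abs_nonneg y]
    have h2 : 1 + d ≤ α * Real.exp (d / α) := by
      have h := Real.add_one_le_exp (d / α)
      calc 1 + d ≤ α * (d / α + 1) := by
            rw [mul_add, mul_div_cancel₀ _ hα0.ne']; linarith
        _ ≤ _ := by gcongr
    have h3 : (1 + |x|) ^ (α / 2) ≤ (1 + |y|) ^ (α / 2) * (α ^ (α / 2) * Real.exp (d / 2)) := by
      calc (1 + |x|) ^ (α / 2) ≤ ((1 + |y|) * (α * Real.exp (d / α))) ^ (α / 2) := by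
            gcongr
            exact h1.trans (by gcongr)
        _ = _ := by
            rw [Real.mul_rpow (by positivity) (by positivity),
              Real.mul_rpow hα0.le (Real.exp_nonneg _), ← Real.exp_mul]
            congr 3
            field_simp
    calc (1 + |x|) ^ (α / 2) * Real.exp (-d)
        ≤ (1 + |y|) ^ (α / 2) * (α ^ (α / 2) * Real.exp (d / 2)) * Real.exp (-d) := by gcongr
      _ = α ^ (α / 2) * ((1 + |y|) ^ (α / 2) * (Real.exp (d / 2) * Real.exp (-d))) := by ring
      _ = _ := by
          rw [← Real.exp_add]
          congr 3; ring

theorem exp_half_sq (x : ℝ) : Real.exp (|x| / 2) ^ 2 = Real.exp |x| := by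
  rw [sq, ← Real.exp_add, add_halves]

theorem rpow_half_sq (α x : ℝ) : ((1 + |x|) ^ (α / 2)) ^ 2 = (1 + |x|) ^ α := by
  rw [← Real.rpow_natCast, ← Real.rpow_mul (by positivity)]
  norm_num

theorem MemFe.weightedBound {Y : SpaceF} (h : Y.MemFe) :
    WeightedBound (fun x => Real.exp (|x| / 2)) Y.normFe Y := by
  refine weightedBound_of_memLp h.q_mem h.w_mem h.h_mem h.U_decay h.w_decay ?_ ?_ <;>
    simp only [exp_half_sq]
  · exact h.h_decay
  · exact le_rfl

theorem WeightedBound.memFe {N : ℝ} {Y : SpaceF}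
    (h : WeightedBound (fun x => Real.exp (|x| / 2)) N Y) :
    Y.MemFe ∧ Y.normFe ≤ Y.normF + 6 * N := by
  obtain ⟨h1, h2, h3, h4, h5, h6⟩ := h.memLp isExpWeight_exp.measurable
  have h7 := h.norm_le
  simp only [exp_half_sq] at h6 h7
  exact ⟨⟨h1, h2, h3, h4, h5, h6⟩, h7⟩

theorem MemFalpha.weightedBound {α : ℝ} {Y : SpaceF} (h : Y.MemFalpha α) :
    WeightedBound (fun x => (1 + |x|) ^ (α / 2)) (Y.normFalpha α) Y := by
  refine weightedBound_of_memLp h.q_mem h.w_mem h.h_mem h.U_decay h.w_decay ?_ ?_ <;>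
    simp only [rpow_half_sq]
  · exact h.h_decay
  · exact le_rfl

theorem WeightedBound.memFalpha {α N : ℝ} (hα : 1 < α) {Y : SpaceF}
    (h : WeightedBound (fun x => (1 + |x|) ^ (α / 2)) N Y) :
    Y.MemFalpha α ∧ Y.normFalpha α ≤ Y.normF + 6 * N := by
  obtain ⟨h1, h2, h3, h4, h5, h6⟩ := h.memLp (isExpWeight_rpow hα).measurable
  have h7 := h.norm_le
  simp only [rpow_half_sq] at h6 h7
  exact ⟨⟨h1, h2, h3, h4, h5, h6⟩, h7⟩

theorem normF_le_normFe (Y : SpaceF) : Y.normF ≤ Y.normFe := by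
  simp only [normFe, add_assoc]
  refine le_add_of_nonneg_right ?_
  exact add_nonneg lpNorm_nonneg (add_nonneg lpNorm_nonneg (add_nonneg lpNorm_nonneg
    (add_nonneg lpNorm_nonneg (add_nonneg lpNorm_nonneg lpNorm_nonneg))))

theorem normF_le_normFalpha (α : ℝ) (Y : SpaceF) : Y.normF ≤ Y.normFalpha α := by
  simp only [normFalpha, add_assoc]
  refine le_add_of_nonneg_right ?_
  exact add_nonneg lpNorm_nonneg (add_nonneg lpNorm_nonneg (add_nonneg lpNorm_nonneg
    (add_nonneg lpNorm_nonneg (add_nonneg lpNorm_nonneg lpNorm_nonneg))))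

/-- A weighted subspace of `F`, given by a predicate and a norm that are equivalent to the weighted
bounds, is preserved by the flow, with bounds for short times and for bounded solutions. -/
theorem weighted_space_preserved {γ : ℝ} {τ : ℝ → ℝ}
    (hτ : ∀ T : ℝ, ∀ Y : ℝ → SpaceF, IsSolution γ T Y → T ≤ τ (Y 0).normF →
      ∀ t ∈ Icc 0 T, ‖Y t‖ ≤ (Y 0).normF + 1)
    {ψ : ℝ → ℝ} {C : ℝ} (hψ : IsExpWeight ψ C) {Mem : SpaceF → Prop} {nrm : SpaceF → ℝ}
    (h₁ : ∀ Y, Mem Y → WeightedBound ψ (nrm Y) Y)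
    (h₂ : ∀ Y N, WeightedBound ψ N Y → Mem Y ∧ nrm Y ≤ Y.normF + 6 * N)
    (h₃ : ∀ Y, Y.normF ≤ nrm Y) :
    (∀ T : ℝ, 0 < T → ∀ Y : ℝ → SpaceF, IsSolution γ T Y → Mem (Y 0) →
      ∀ t ∈ Icc 0 T, Mem (Y t)) ∧
    (∃ C : ℝ → ℝ → ℝ, ∀ T : ℝ, 0 < T → ∀ Y : ℝ → SpaceF,
      IsSolution γ T Y → T ≤ τ (Y 0).normF → Mem (Y 0) →
        ∀ t ∈ Icc 0 T, nrm (Y t) ≤ C T (nrm (Y 0))) ∧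
    (∃ C : ℝ → ℝ → ℝ → ℝ, ∀ T : ℝ, 0 < T → ∀ M : ℝ, ∀ Y : ℝ → SpaceF,
      IsSolution γ T Y → (∀ t ∈ Icc 0 T, (Y t).normF ≤ M) → Mem (Y 0) →
        ∀ t ∈ Icc 0 T, nrm (Y t) ≤ C T M (nrm (Y 0))) := by
  choose K hK using fun T M N : ℝ => exists_weightedBound γ T M C N
  -- The 6 counts the terms of the norm beyond ‖·‖_F, and the 7 comes from `normF_le`. For short
  -- times N + 1 bounds the solution in the product norm.
  refine ⟨fun T _ Y hY h0 t ht => ?_, ⟨fun T N => 7 * (N + 1) + 6 * K T (N + 1) N,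
    fun T _ Y hY hT h0 t ht => ?_⟩, ⟨fun T M N => M + 6 * K T M N, fun T _ M Y hY hM h0 t ht => ?_⟩⟩
  -- For mere membership a bound depending on the particular solution suffices, and compactness of
  -- [0, T] provides one.
  · obtain ⟨R, hR⟩ := exists_norm_le_of_hasDerivWithinAt hY.hasDerivWithinAt
    exact (h₂ _ _ (hK T R _ Y hY hR ψ hψ (h₁ _ h0) t ht)).1
  · have hM : ∀ t ∈ Icc 0 T, ‖Y t‖ ≤ nrm (Y 0) + 1 := fun t ht =>
      (hτ T Y hY hT t ht).trans (by linarith [h₃ (Y 0)])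
    have h := (h₂ _ _ (hK T _ _ Y hY hM ψ hψ (h₁ _ h0) t ht)).2
    linarith [normF_le (Y t), hM t ht]
  · have h := (h₂ _ _ (hK T M _ Y hY (fun t ht => (norm_le_normF _).trans (hM t ht)) ψ hψ
      (h₁ _ h0) t ht)).2
    linarith [hM t ht]

end SpaceF

end

theorem mainTheorem5 (γ : ℝ) :
    -- the length of the short-time existence interval is a function `τ` of `‖Y₀‖_F` only
    ∃ τ : ℝ → ℝ, (∀ r, 0 < τ r) ∧
    -- short-time solutions exist on `[0, τ(‖Y₀‖_F)]`; solutions are unique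
    (∀ Y₀ : SpaceF, ∃ Y : ℝ → SpaceF,
      SpaceF.IsSolution γ (τ Y₀.normF) Y ∧ Y 0 = Y₀) ∧
    (∀ T : ℝ, 0 < T → ∀ Y Z : ℝ → SpaceF,
      SpaceF.IsSolution γ T Y → SpaceF.IsSolution γ T Z → Y 0 = Z 0 →
        ∀ t ∈ Icc 0 T, Y t = Z t) ∧
    -- `F^e` is preserved by the flow, on every interval on which the solution exists
    (∀ T : ℝ, 0 < T → ∀ Y : ℝ → SpaceF, SpaceF.IsSolution γ T Y → (Y 0).MemFe →
      ∀ t ∈ Icc 0 T, (Y t).MemFe) ∧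
    -- bound for the short-time solutions in `F^e`
    (∃ C : ℝ → ℝ → ℝ, ∀ T : ℝ, 0 < T → ∀ Y : ℝ → SpaceF,
      SpaceF.IsSolution γ T Y → T ≤ τ (Y 0).normF → (Y 0).MemFe →
        ∀ t ∈ Icc 0 T, (Y t).normFe ≤ C T (Y 0).normFe) ∧
    -- bound in `F^e` on any interval on which the solution is bounded in `F`
    (∃ C : ℝ → ℝ → ℝ → ℝ, ∀ T : ℝ, 0 < T → ∀ M : ℝ, ∀ Y : ℝ → SpaceF,
      SpaceF.IsSolution γ T Y → (∀ t ∈ Icc 0 T, (Y t).normF ≤ M) → (Y 0).MemFe →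
        ∀ t ∈ Icc 0 T, (Y t).normFe ≤ C T M (Y 0).normFe) ∧
    -- the same three facts for `F^α`
    (∀ α : ℝ, 1 < α →
      (∀ T : ℝ, 0 < T → ∀ Y : ℝ → SpaceF, SpaceF.IsSolution γ T Y → (Y 0).MemFalpha α →
        ∀ t ∈ Icc 0 T, (Y t).MemFalpha α) ∧
      (∃ C : ℝ → ℝ → ℝ, ∀ T : ℝ, 0 < T → ∀ Y : ℝ → SpaceF,
        SpaceF.IsSolution γ T Y → T ≤ τ (Y 0).normF → (Y 0).MemFalpha α →
          ∀ t ∈ Icc 0 T, (Y t).normFalpha α ≤ C T ((Y 0).normFalpha α)) ∧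
      (∃ C : ℝ → ℝ → ℝ → ℝ, ∀ T : ℝ, 0 < T → ∀ M : ℝ, ∀ Y : ℝ → SpaceF,
        SpaceF.IsSolution γ T Y → (∀ t ∈ Icc 0 T, (Y t).normF ≤ M) → (Y 0).MemFalpha α →
          ∀ t ∈ Icc 0 T, (Y t).normFalpha α ≤ C T M ((Y 0).normFalpha α))) := by
  obtain ⟨τ, hτ0, hτ⟩ := (SpaceF.lipschitzOnBounded_vectorField γ).exists_solution
  have huniq : ∀ T : ℝ, ∀ Y Z : ℝ → SpaceF, SpaceF.IsSolution γ T Y → SpaceF.IsSolution γ T Z →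
      Y 0 = Z 0 → ∀ t ∈ Icc 0 T, Y t = Z t := fun T Y Z hY hZ h0 t ht =>
    (SpaceF.lipschitzOnBounded_vectorField γ).eqOn_of_hasDerivWithinAt hY.hasDerivWithinAt
      hZ.hasDerivWithinAt h0 ht
  -- By uniqueness, a solution on a short interval is a restriction of the Picard solution, so it
  -- inherits the bound that comes with the construction.
  have hshort : ∀ T : ℝ, ∀ Y : ℝ → SpaceF, SpaceF.IsSolution γ T Y → T ≤ τ (Y 0).normF →
      ∀ t ∈ Icc 0 T, ‖Y t‖ ≤ (Y 0).normF + 1 := by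
    intro T Y hY hT t ht
    obtain ⟨Z, hZ0, hZ⟩ := hτ (Y 0).normF (Y 0) (SpaceF.norm_le_normF _)
    have hsub : Icc 0 T ⊆ Icc 0 (τ (Y 0).normF) := Icc_subset_Icc_right hT
    have hZ' : SpaceF.IsSolution γ T Z :=
      SpaceF.isSolution_of_hasDerivWithinAt fun s hs => (hZ s (hsub hs)).1.mono hsub
    rw [huniq T Y Z hY hZ' hZ0.symm t ht]
    exact (hZ t (hsub ht)).2
  obtain ⟨e1, e2, e3⟩ := SpaceF.weighted_space_preserved hshort SpaceF.isExpWeight_exp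
    (fun _ h => h.weightedBound) (fun _ _ h => h.memFe) SpaceF.normF_le_normFe
  refine ⟨τ, hτ0, fun Y₀ => ?_, fun T _ => huniq T, e1, e2, e3, fun α hα => ?_⟩
  · obtain ⟨Z, hZ0, hZ⟩ := hτ Y₀.normF Y₀ (SpaceF.norm_le_normF _)
    exact ⟨Z, SpaceF.isSolution_of_hasDerivWithinAt fun t ht => (hZ t ht).1, hZ0⟩
  · exact SpaceF.weighted_space_preserved hshort (SpaceF.isExpWeight_rpow hα)
      (fun _ h => h.weightedBound) (fun _ _ h => h.memFalpha hα) (SpaceF.normF_le_normFalpha α)
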